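/- All graphs are finite and simple, and are not required to be connected. For integers $v,k,g,\lambda$, a \emph{$vgr(v,k,g,\lambda)$-graph} is a $k$-regular graph on $v$ vertices, of girth $g$ (the length of a shortest cycle), in which every vertex is contained in exactly $\lambda$ cycles of length $g$ (cycles being counted as subgraphs, that is, without a starting vertex or a direction). For each of the following triples $(k,g,\lambda)$ of integers there are infinitely many integers $v$ such that a $vgr(v,k,g,\lambda)$-graph exists: (i) $\lambda=1$ and $k,g\ge 3$; (ii) $\lambda=2$, $k\ge 4$ and $g\ge 3$; (iii) $\lambda\ge 3$, $k\ge\lambda$, $g\ge 3$ and $g\notin\{4,5\}$. -/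

import Mathlib

namespace VertexGirthRegular

/-- `H` is a cycle of length `n` in `G`, regarded as a subgraph: two closed walks which differ
only in their starting vertex or their direction give the same cycle. -/
def IsCycleOfLength {V : Type*} {G : SimpleGraph V} (H : G.Subgraph) (n : ℕ) : Prop :=
  ∃ (a : V) (c : G.Walk a a), c.IsCycle ∧ c.length = n ∧ c.toSubgraph = H

/-- `G` is a `vgr(v,k,g,lam)`-graph: a simple `k`-regular graph of order `v` and girth `g` in which
every vertex is contained in exactly `lam` cycles of length `g`. -/
structure IsVGR {V : Type*} [Fintype V] (G : SimpleGraph V) [G.LocallyFinite]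
    (v k g lam : ℕ) : Prop where
  card_eq : Fintype.card V = v
  regular : G.IsRegularOfDegree k
  girth_eq : G.egirth = (g : ℕ∞)
  cycles_eq : ∀ u : V, {H : G.Subgraph | IsCycleOfLength H g ∧ u ∈ H.verts}.ncard = lam

/-- There is a `vgr(v,k,g,lam)`-graph (its vertices may be labelled by `Fin v`). -/
def ExistsVGR (v k g lam : ℕ) : Prop :=
  ∃ (G : SimpleGraph (Fin v)) (_ : G.LocallyFinite), IsVGR G v k g lam

end VertexGirthRegular

/-! ### Cycles as vertex sequences, and blocks -/

section

open SimpleGraph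

/-! The graphs are assembled from blocks: `d`-regular graphs without cycles shorter than `g` in
which every vertex lies on exactly `l` cycles of length `g`. The key fact, `HasBlock.sum`, is that
finite blocks for the same `g` can be superposed so that both `d` and `l` add up. A cycle of length
`g` has `(d, l) = (2, 1)`, a single edge has `(1, 0)`, and an edgeless graph of any size has `(0,
0)`. So `λ = 1` and `λ = 2` need one or two cycles and some edges, and `λ ≥ 3` needs one block with
`d = l = λ` and some edges. The edgeless block makes the order arbitrarily large.

To superpose blocks, give each vertex set a group structure, form the free product, and pass to a
finite quotient `P` in which no nontrivial element with few syllables dies. Place a copy of block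
`i` on every right coset of factor `i` in `P`. A short cycle of the union lifts to a closed sequence
in the free product, and by normal forms such a sequence without repetitions uses one factor only.
Hence the short cycles all lie inside copies of single blocks.

The block with `d = l = λ` is the graph of a map with `g`-gonal faces, `λ` at each vertex, whose
only cycles of length at most `g` are the face boundaries. The map is encoded by a rotation `r`
about a vertex and a half turn `s` about an edge midpoint, and the condition says which short words
in the `r ^ j * s` are trivial (`IsMapPair`). For `g ≥ 6` and `λ ≥ 3`, start from the regular
tessellation, which is hyperbolic (Euclidean if `g = 6`, `λ = 3`). There a Cauchy arm lemma applies: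
a closed polygon of at most `g` edges of the same length, turning nowhere more sharply than the
regular `g`-gon, is that `g`-gon. The rotations are real matrices; reducing their entries to a
finite field keeps finitely many words nontrivial and makes the group finite. For `g = 3` the
tetrahedron, octahedron and icosahedron are checked directly, and larger `λ` follows by adding
tetrahedra. -/

/-- `p` parametrises a cycle of length `n` of `G`, as a sequence of vertices. -/
structure IsCyc {V : Type*} (G : SimpleGraph V) (n : ℕ) (p : ℕ → V) : Prop where
  three_le : 3 ≤ n
  closed : p n = p 0
  adj : ∀ k < n, G.Adj (p k) (p (k + 1))
  inj : ∀ i < n, ∀ j < n, p i = p j → i = j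

/-- The edges traversed by the first `n` steps of `p`. -/
def stepEdges {V : Type*} (n : ℕ) (p : ℕ → V) : Set (Sym2 V) :=
  {e | ∃ k < n, e = s(p k, p (k + 1))}

/-- The edge sets of the cycles of length `n` through `u`. -/
def cycSets {V : Type*} (G : SimpleGraph V) (n : ℕ) (u : V) : Set (Set (Sym2 V)) :=
  {E | ∃ p, IsCyc G n p ∧ p 0 = u ∧ E = stepEdges n p}

/-- `G` is `d`-regular, its cycles have length at least `g`, and every vertex lies on exactly `l`
cycles of length `g`. -/
structure IsBlock {V : Type*} (G : SimpleGraph V) (g d l : ℕ) : Prop where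
  regular : ∀ u, (G.neighborSet u).ncard = d
  girth : ∀ n p, IsCyc G n p → g ≤ n
  cycles : ∀ u, (cycSets G g u).ncard = l

theorem exists_walk_of_seq {V : Type*} {G : SimpleGraph V} (n : ℕ) (p : ℕ → V)
    (h : ∀ k < n, G.Adj (p k) (p (k + 1))) :
    ∃ w : G.Walk (p 0) (p n), w.length = n ∧ ∀ k ≤ n, w.getVert k = p k := by
  induction n generalizing p with
  | zero => exact ⟨Walk.nil, rfl, fun k hk => by simp [Nat.le_zero.1 hk]⟩
  | succ n ih =>
    obtain ⟨w, hw, hv⟩ := ih (fun k => p (k + 1)) fun k hk => h (k + 1) (by lia)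
    refine ⟨Walk.cons (h 0 (by lia)) w, by simp [hw], fun k hk => ?_⟩
    cases k with
    | zero => simp
    | succ k => rw [Walk.getVert_cons_succ]; exact hv k (by lia)

theorem edgeSet_eq_stepEdges {V : Type*} {G : SimpleGraph V} {u v : V} (w : G.Walk u v) :
    w.edgeSet = stepEdges w.length w.getVert := by
  ext e
  rw [← Walk.edgeSet_toSubgraph]
  induction e with | _ a b => ?_
  rw [Subgraph.mem_edgeSet, Walk.toSubgraph_adj_iff]
  constructor
  · rintro ⟨i, h, hi⟩; exact ⟨i, hi, h.symm⟩
  · rintro ⟨i, h, hi⟩; exact ⟨i, hi.symm, h⟩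

theorem SimpleGraph.Walk.IsCycle.isCyc {V : Type*} {G : SimpleGraph V} {u : V} {w : G.Walk u u}
    (hw : w.IsCycle) : IsCyc G w.length w.getVert where
  three_le := hw.three_le_length
  closed := by simp
  adj := fun k hk => w.adj_getVert_succ hk
  inj := fun i hi j hj h => hw.getVert_injOn' (by grind) (by grind) h

theorem IsCyc.exists_isCycle {V : Type*} {G : SimpleGraph V} {n : ℕ} {p : ℕ → V}
    (hp : IsCyc G n p) :
    ∃ w : G.Walk (p 0) (p 0), w.IsCycle ∧ w.length = n ∧ w.edgeSet = stepEdges n p := by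
  obtain ⟨w, hw, hv⟩ := exists_walk_of_seq n p hp.adj
  have h3 := hp.three_le
  have hc := hp.closed
  obtain ⟨w', hw', hv'⟩ : ∃ w' : G.Walk (p 0) (p 0), w'.length = n ∧
      ∀ k ≤ n, w'.getVert k = p k := ⟨w.copy rfl hc, by simpa using hw, by simpa using hv⟩
  refine ⟨w', ?_, hw', ?_⟩
  · rw [Walk.isCycle_iff_isPath_tail_and_le_length, ← Walk.IsPath.getVert_injOn_iff]
    refine ⟨fun i hi j hj hij => ?_, by lia⟩
    have hnil : ¬ w'.Nil := by rw [← Walk.length_eq_zero_iff]; lia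
    have ht := Walk.length_tail_add_one hnil
    simp only [Set.mem_ofPred_eq] at hi hj
    rw [Walk.getVert_tail, Walk.getVert_tail, hv' _ (by lia), hv' _ (by lia)] at hij
    -- The tail visits `p 1, …, p n`, while injectivity is known on `0, …, n - 1`; the index `n` is
    -- replaced by `0`.
    rcases Nat.lt_or_ge (i + 1) n with h1 | h1 <;> rcases Nat.lt_or_ge (j + 1) n with h2 | h2
    · have := hp.inj _ h1 _ h2 hij; lia
    · rw [show j + 1 = n by lia, hc] at hij
      have := hp.inj _ h1 0 (by lia) hij; lia
    · rw [show i + 1 = n by lia, hc] at hij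
      have := hp.inj _ (show 0 < n by lia) _ h2 hij; lia
    · lia
  · rw [edgeSet_eq_stepEdges, hw']
    ext e
    constructor <;> rintro ⟨k, hk, rfl⟩ <;> refine ⟨k, hk, ?_⟩ <;>
      rw [hv' _ (by lia), hv' _ (by lia)]

/-- The vertices of a nonconstant walk are the ends of its edges. This is what allows cycles to be
counted by their edge sets. -/
theorem toSubgraph_eq_of_edgeSet_eq {V : Type*} {G : SimpleGraph V} {u v : V} {w : G.Walk u u}
    {w' : G.Walk v v} (hw : ¬ w.Nil) (hw' : ¬ w'.Nil)
    (h : w.toSubgraph.edgeSet = w'.toSubgraph.edgeSet) : w.toSubgraph = w'.toSubgraph := by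
  have hadj : ∀ a b, w.toSubgraph.Adj a b ↔ w'.toSubgraph.Adj a b := fun a b => by
    rw [← Subgraph.mem_edgeSet, ← Subgraph.mem_edgeSet, h]
  have key : ∀ {x : V} {z : G.Walk x x}, ¬ z.Nil → ∀ a,
      a ∈ z.toSubgraph.verts ↔ ∃ e ∈ z.toSubgraph.edgeSet, a ∈ e := by
    intro x z hz a
    rw [Walk.mem_verts_toSubgraph, Walk.mem_support_iff_exists_mem_edges_of_not_nil hz]
    simp only [Walk.mem_edges_toSubgraph]
  refine Subgraph.ext ?_ (by ext a b; exact hadj a b)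
  ext a
  rw [key hw, key hw', h]

theorem ncard_cycles_eq {V : Type*} (G : SimpleGraph V) (n : ℕ) (u : V) :
    {H : G.Subgraph | VertexGirthRegular.IsCycleOfLength H n ∧ u ∈ H.verts}.ncard =
      (cycSets G n u).ncard := by
  classical
  refine Set.ncard_congr (fun H _ => H.edgeSet) ?_ ?_ ?_
  · rintro H ⟨⟨a, c, hc, rfl, rfl⟩, hu⟩
    rw [Walk.mem_verts_toSubgraph] at hu
    have hr : (c.rotate u hu).IsCycle := hc.rotate hu
    refine ⟨_, (by simpa using hr.isCyc), by simp, ?_⟩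
    rw [← Walk.toSubgraph_rotate c hu, Walk.edgeSet_toSubgraph, edgeSet_eq_stepEdges]
    simp
  · rintro H H' ⟨⟨a, c, hc, rfl, rfl⟩, -⟩ ⟨⟨a', c', hc', -, rfl⟩, -⟩ h
    exact toSubgraph_eq_of_edgeSet_eq hc.not_nil hc'.not_nil h
  · rintro E ⟨p, hp, rfl, rfl⟩
    obtain ⟨w, hw, hl, he⟩ := hp.exists_isCycle
    exact ⟨w.toSubgraph, ⟨⟨_, w, hw, hl, rfl⟩, w.start_mem_verts_toSubgraph⟩,
      by rw [Walk.edgeSet_toSubgraph, he]⟩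

theorem IsCyc.of_le {V : Type*} {G H : SimpleGraph V} (hle : G ≤ H) {n : ℕ} {p : ℕ → V}
    (hp : IsCyc G n p) : IsCyc H n p :=
  ⟨hp.three_le, hp.closed, fun k hk => hle (hp.adj k hk), hp.inj⟩

theorem cycSets_mono {V : Type*} {G H : SimpleGraph V} (hle : G ≤ H) (n : ℕ) (u : V) :
    cycSets G n u ⊆ cycSets H n u := by
  rintro E ⟨p, hp, rfl, rfl⟩
  exact ⟨p, hp.of_le hle, rfl, rfl⟩

theorem IsCyc.map {V W : Type*} {G : SimpleGraph V} {H : SimpleGraph W} {f : V → W}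
    (hf : Function.Injective f) (hadj : ∀ a b, G.Adj a b → H.Adj (f a) (f b)) {n : ℕ} {p : ℕ → V}
    (hp : IsCyc G n p) : IsCyc H n (f ∘ p) :=
  ⟨hp.three_le, congrArg f hp.closed, fun k hk => hadj _ _ (hp.adj k hk),
    fun i hi j hj h => hp.inj i hi j hj (hf h)⟩

theorem stepEdges_comp {V W : Type*} (f : V → W) (n : ℕ) (p : ℕ → V) :
    stepEdges n (f ∘ p) = Sym2.map f '' stepEdges n p := by
  ext e
  constructor
  · rintro ⟨k, hk, rfl⟩; exact ⟨_, ⟨k, hk, rfl⟩, rfl⟩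
  · rintro ⟨_, ⟨k, hk, rfl⟩, rfl⟩; exact ⟨k, hk, rfl⟩

section Component

variable {V W : Type*} {H : SimpleGraph V} {G : SimpleGraph W} {f : V → W}
  (hf : Function.Injective f) (hadj : ∀ a w, G.Adj (f a) w ↔ ∃ b, H.Adj a b ∧ w = f b)

include hf hadj

theorem ncard_neighborSet_of_component (a : V) :
    (G.neighborSet (f a)).ncard = (H.neighborSet a).ncard := by
  rw [← Set.ncard_image_of_injective _ hf]
  congr 1
  ext w
  simp only [mem_neighborSet, hadj, Set.mem_image]
  exact ⟨fun ⟨b, h, e⟩ => ⟨b, h, e.symm⟩, fun ⟨b, h, e⟩ => ⟨b, h, e.symm⟩⟩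

/-- The hypothesis `hadj` makes the image of `f` closed under adjacency, so a cycle that starts in
it never leaves it. -/
theorem IsCyc.exists_lift_of_component {n : ℕ} {p : ℕ → W} (hp : IsCyc G n p) {a : V}
    (h0 : p 0 = f a) : ∃ q, IsCyc H n q ∧ q 0 = a ∧ ∀ k ≤ n, p k = f (q k) := by
  have hmem : ∀ k, k ≤ n → ∃ b, p k = f b := by
    intro k
    induction k with
    | zero => exact fun _ => ⟨a, h0⟩
    | succ k ih =>
      intro hk
      obtain ⟨b, hb⟩ := ih (by lia)
      obtain ⟨b', -, hb'⟩ := (hadj b (p (k + 1))).1 (hb ▸ hp.adj k (by lia))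
      exact ⟨b', hb'⟩
  have : ∀ k, ∃ b, k ≤ n → p k = f b := fun k => by
    by_cases hk : k ≤ n
    · obtain ⟨b, hb⟩ := hmem k hk; exact ⟨b, fun _ => hb⟩
    · exact ⟨a, fun h => absurd h hk⟩
  choose q hq using this
  have h3 := hp.three_le
  refine ⟨q, ⟨h3, hf ?_, fun k hk => ?_, fun i hi j hj h => ?_⟩, hf ?_, hq⟩
  · rw [← hq _ le_rfl, ← hq _ (by lia), hp.closed]
  · have := hp.adj k hk
    rw [hq _ hk.le, hq _ hk, hadj] at this
    obtain ⟨b, hb, e⟩ := this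
    rwa [hf e]
  · exact hp.inj i hi j hj (by rw [hq _ hi.le, hq _ hj.le, h])
  · rw [← hq _ (by lia), h0]

theorem ncard_cycSets_of_component (n : ℕ) (a : V) :
    (cycSets G n (f a)).ncard = (cycSets H n a).ncard := by
  have hinj : Function.Injective fun E : Set (Sym2 V) => Sym2.map f '' E :=
    Set.image_injective.2 (Sym2.map.injective hf)
  rw [← Set.ncard_image_of_injective _ hinj]
  congr 1
  ext E
  constructor
  · rintro ⟨p, hp, h0, rfl⟩
    obtain ⟨q, hq, hq0, hpq⟩ := hp.exists_lift_of_component hf hadj h0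
    refine ⟨_, ⟨q, hq, hq0, rfl⟩, ?_⟩
    simp only [← stepEdges_comp]
    ext e
    constructor <;> rintro ⟨k, hk, rfl⟩ <;> refine ⟨k, hk, ?_⟩ <;>
      simp [hpq k hk.le, hpq (k + 1) hk]
  · rintro ⟨_, ⟨q, hq, rfl, rfl⟩, rfl⟩
    exact ⟨f ∘ q, hq.map hf fun a b h => (hadj _ _).2 ⟨b, h, rfl⟩, rfl, (stepEdges_comp ..).symm⟩

end Component

theorem IsBlock.of_iso {V W : Type*} {G : SimpleGraph V} {H : SimpleGraph W} (e : G ≃g H)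
    {g d l : ℕ} (hG : IsBlock G g d l) : IsBlock H g d l := by
  have hadj : ∀ a w, H.Adj (e a) w ↔ ∃ b, G.Adj a b ∧ w = e b := fun a w => by
    constructor
    · intro h
      exact ⟨e.symm w, by rw [← e.map_adj_iff]; simpa using h, by simp⟩
    · rintro ⟨b, h, rfl⟩; exact e.map_adj_iff.2 h
  refine ⟨fun u => ?_, fun n p hp => ?_, fun u => ?_⟩
  · obtain ⟨a, rfl⟩ := e.surjective u
    rw [ncard_neighborSet_of_component e.injective hadj, hG.regular]
  · obtain ⟨a, ha⟩ := e.surjective (p 0)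
    obtain ⟨q, hq, -⟩ := hp.exists_lift_of_component e.injective hadj ha.symm
    exact hG.girth n q hq
  · obtain ⟨a, rfl⟩ := e.surjective u
    rw [ncard_cycSets_of_component e.injective hadj, hG.cycles]

/-- A block only bounds the girth from below; `l ≠ 0` supplies a cycle of length `g`. -/
theorem IsBlock.existsVGR {V : Type*} [Finite V] [Nonempty V] {G : SimpleGraph V} {g d l : ℕ}
    (hG : IsBlock G g d l) (hl : l ≠ 0) : VertexGirthRegular.ExistsVGR (Nat.card V) d g l := by
  classical
  have hH := hG.of_iso (Iso.map (Finite.equivFin V) G)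
  set H := G.map (Finite.equivFin V)
  have : Nonempty (Fin (Nat.card V)) := (Finite.equivFin V).nonempty_congr.1 ‹_›
  refine ⟨H, inferInstance, by simp, fun v => ?_, ?_, fun u => ?_⟩
  · rw [← hH.regular v, degree]
    exact (Set.ncard_coe_finset _).symm.trans (congrArg Set.ncard (coe_neighborFinset H v))
  · apply le_antisymm
    · obtain ⟨u⟩ := this
      have : (cycSets H g u).Nonempty := by
        rw [Set.nonempty_iff_ne_empty]
        intro h
        have := hH.cycles u
        rw [h, Set.ncard_empty] at this
        exact hl this.symm
      obtain ⟨_, p, hp, -, -⟩ := this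
      obtain ⟨w, hw, hlen, -⟩ := hp.exists_isCycle
      exact hlen ▸ egirth_le_length hw
    · rw [le_egirth]
      intro a w hw
      exact_mod_cast hH.girth _ _ hw.isCyc
  · rw [ncard_cycles_eq, hH.cycles]

/-- There is a finite nonempty block with the given parameters and at least `m` vertices. -/
def HasBlock (g d l m : ℕ) : Prop :=
  ∃ (V : Type) (_ : Finite V) (_ : Nonempty V) (G : SimpleGraph V),
    IsBlock G g d l ∧ m ≤ Nat.card V

theorem infinite_of_hasBlock {g d l : ℕ} (hl : l ≠ 0) (h : ∀ m, HasBlock g d l m) :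
    {v : ℕ | VertexGirthRegular.ExistsVGR v d g l}.Infinite := by
  refine Set.infinite_of_not_bddAbove ?_
  rintro ⟨b, hb⟩
  obtain ⟨V, _, _, G, hG, hm⟩ := h (b + 1)
  have := hb (hG.existsVGR hl)
  lia

end

/-! ### Finite quotients and normal forms of free products -/

section

open SimpleGraph Monoid

section Truncation

universe u v

variable {ι : Type u} {M : ι → Type v} [∀ i, Group (M i)] [DecidableEq ι]
  [∀ i, DecidableEq (M i)]

namespace Monoid.CoprodI.Word

theorem equivPair_rcons {i : ι} (p : Pair M i) : equivPair i (rcons p) = p := by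
  rw [← equivPair_symm, Equiv.apply_symm_apply]

theorem smul_rcons {i : ι} (m : M i) (p : Pair M i) :
    m • rcons p = rcons { p with head := m * p.head } := by
  rw [smul_def]
  simp only [equivPair_rcons]

omit [DecidableEq ι] in
theorem length_rcons {i : ι} (p : Pair M i) :
    (rcons p).toList.length = if p.head = 1 then p.tail.toList.length
      else p.tail.toList.length + 1 := by
  unfold rcons
  split_ifs <;> simp [cons]

theorem exists_eq_rcons (i : ι) (w : Word M) : ∃ p : Pair M i, w = rcons p :=
  ⟨equivPair i w, by rw [← equivPair_symm, Equiv.symm_apply_apply]⟩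

theorem length_smul_le {i : ι} (m : M i) (w : Word M) :
    (m • w).toList.length ≤ w.toList.length + 1 := by
  obtain ⟨p, rfl⟩ := exists_eq_rcons i w
  rw [smul_rcons, length_rcons, length_rcons]
  dsimp only
  split_ifs <;> lia

theorem length_smul_le_of_ne {i : ι} (m : M i) (w : Word M) {N : ℕ} (hw : w.toList.length ≤ N)
    (h : (equivPair i w).tail.toList.length + 1 ≤ N) : (m • w).toList.length ≤ N := by
  obtain ⟨p, rfl⟩ := exists_eq_rcons i w
  rw [equivPair_rcons] at h
  rw [smul_rcons, length_rcons]
  dsimp only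
  split_ifs <;> lia

/-- Whether `truncSmul` fixes a word depends only on this tail, so the case distinction is invariant
under the factor and truncation still gives an action. -/
theorem tail_smul {i : ι} (m : M i) (w : Word M) :
    (equivPair i (m • w)).tail = (equivPair i w).tail := by
  rw [smul_eq_of_smul, equivPair_smul_same]

/-- The words with at most `N` syllables. -/
abbrev Trunc (M : ι → Type*) [∀ i, Group (M i)] (N : ℕ) := {w : Word M // w.toList.length ≤ N}

/-- Left multiplication by an element of a factor on the words with at most `N` syllables; the
words for which it could produce a longer word are fixed. -/
def truncSmul (N : ℕ) {i : ι} (m : M i) (w : Trunc M N) : Trunc M N :=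
  if h : (equivPair i w.1).tail.toList.length + 1 ≤ N then
    ⟨m • w.1, length_smul_le_of_ne m w.1 w.2 h⟩ else w

theorem truncSmul_of_le {N : ℕ} {i : ι} (m : M i) {w : Trunc M N}
    (h : (equivPair i w.1).tail.toList.length + 1 ≤ N) :
    truncSmul N m w = ⟨m • w.1, length_smul_le_of_ne m w.1 w.2 h⟩ := dif_pos h

theorem truncSmul_of_not_le {N : ℕ} {i : ι} (m : M i) {w : Trunc M N}
    (h : ¬ (equivPair i w.1).tail.toList.length + 1 ≤ N) : truncSmul N m w = w := dif_neg h

theorem tail_length_le {i : ι} (w : Word M) :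
    (equivPair i w).tail.toList.length ≤ w.toList.length := by
  obtain ⟨p, rfl⟩ := exists_eq_rcons i w
  rw [equivPair_rcons, length_rcons]
  split_ifs <;> lia

/-- The action of a factor on the words with at most `N` syllables. -/
@[reducible]
def truncAction (M : ι → Type*) [∀ i, Group (M i)] [∀ i, DecidableEq (M i)] (N : ℕ) (i : ι) :
    MulAction (M i) (Trunc M N) where
  smul := truncSmul N
  one_smul w := by
    change truncSmul N 1 w = w
    by_cases h : (equivPair i w.1).tail.toList.length + 1 ≤ N
    · rw [truncSmul_of_le _ h]; simp
    · rw [truncSmul_of_not_le _ h]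
  mul_smul m m' w := by
    change truncSmul N (m * m') w = truncSmul N m (truncSmul N m' w)
    by_cases h : (equivPair i w.1).tail.toList.length + 1 ≤ N
    · rw [truncSmul_of_le _ h, truncSmul_of_le m' h, truncSmul_of_le m (by rwa [tail_smul])]
      simp [mul_smul]
    · rw [truncSmul_of_not_le _ h, truncSmul_of_not_le _ h, truncSmul_of_not_le _ h]

instance [Finite ι] [∀ i, Finite (M i)] (N : ℕ) : Finite (Trunc M N) := by
  have : Finite {l : List (Σ i, M i) // l.length ≤ N} := List.finite_length_le _ _
  refine Finite.of_injective
    (fun w => (⟨w.1.toList, w.2⟩ : {l : List (Σ i, M i) // l.length ≤ N})) fun v w h => ?_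
  simp only [Subtype.mk.injEq] at h
  exact Subtype.ext (Word.ext h)

/-- The free product acts on the words with at most `N` syllables. -/
noncomputable def truncHom (M : ι → Type*) [∀ i, Group (M i)] [∀ i, DecidableEq (M i)] (N : ℕ) :
    CoprodI M →* Equiv.Perm (Trunc M N) :=
  CoprodI.lift fun i => @MulAction.toPermHom _ _ _ (truncAction M N i)

theorem truncHom_of {N : ℕ} {i : ι} (m : M i) (w : Trunc M N) :
    truncHom M N (of m) w = truncSmul N m w := by
  rw [truncHom, CoprodI.lift_of]
  rfl

/-- Prepending syllables one by one only meets suffixes of `w`, which are short enough for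
truncation not to interfere. So a short element can be read off from its action on the empty word.
-/
theorem truncHom_prod {N : ℕ} (w : Word M) (hw : w.toList.length ≤ N) :
    truncHom M N w.prod ⟨Word.empty, by simp [Word.empty]⟩ = ⟨w, hw⟩ := by
  induction w using Word.consRecOn with
  | empty => simp
  | cons i m w h1 h2 ih =>
    have hl : w.toList.length + 1 ≤ N := by simpa [Word.cons] using hw
    rw [Word.prod_cons, map_mul, Equiv.Perm.mul_apply, ih (by lia), truncHom_of,
      truncSmul_of_le _ (le_trans (Nat.succ_le_succ (tail_length_le w)) hl)]
    simp [Word.cons_eq_smul, smul_eq_of_smul]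

end Monoid.CoprodI.Word

open Monoid.CoprodI

/-- The number of syllables of an element of a free product. -/
def syllables (x : CoprodI M) : ℕ := (Word.equiv x).toList.length

theorem equiv_of_mul {i : ι} (m : M i) (x : CoprodI M) :
    Word.equiv (of m * x) = m • Word.equiv x := by
  simp [Word.equiv, mul_smul, Word.smul_eq_of_smul]

theorem syllables_of_mul_le {i : ι} (m : M i) (x : CoprodI M) :
    syllables (of m * x) ≤ syllables x + 1 := by
  rw [syllables, equiv_of_mul]
  exact Word.length_smul_le _ _

theorem syllables_one : syllables (1 : CoprodI M) = 0 := by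
  simp [syllables, Word.equiv, Word.empty]

/-- Free products of finitely many finite groups are residually finite, uniformly on the elements
with a bounded number of syllables. -/
theorem exists_finite_quotient_coprodI [Finite ι] [∀ i, Finite (M i)] (N : ℕ) :
    ∃ (P : Type (max u v)) (_ : Group P) (_ : Finite P) (Φ : CoprodI M →* P),
      ∀ x, syllables x ≤ N → Φ x = 1 → x = 1 := by
  refine ⟨Equiv.Perm (Word.Trunc M N), inferInstance, inferInstance, Word.truncHom M N,
    fun x hx h => ?_⟩
  have h1 := Word.truncHom_prod (Word.equiv x) hx
  have h2 : (Word.equiv x).prod = x := Word.equiv.symm_apply_apply x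
  rw [h2, h] at h1
  have h3 : (Word.empty : Word M) = Word.equiv x := congrArg Subtype.val h1
  rw [← h2, ← h3, Word.prod_empty]

theorem fstIdx_equiv_of_mul {i : ι} {m : M i} (hm : m ≠ 1) {x : CoprodI M}
    (hx : (Word.equiv x).fstIdx ≠ some i) : (Word.equiv (of m * x)).fstIdx = some i := by
  rw [equiv_of_mul, Word.smul_eq_of_smul, ← Word.cons_eq_smul (h1 := hx) (h2 := hm),
    Word.fstIdx_cons]

/-- A sequence of left multiplications by elements of the factors which returns to `1` without
repeating an earlier value uses one factor only. -/
theorem idx_eq_of_closed {n : ℕ} (hn : 0 < n) {w : ℕ → CoprodI M} (idx : ℕ → ι)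
    (hstep : ∀ k < n, ∃ m : M (idx k), w (k + 1) = of m * w k) (h0 : w 0 = 1) (hw : w n = 1)
    (hinj : ∀ i < n, ∀ j < n, w i = w j → i = j) : ∀ k < n, idx k = idx 0 := by
  -- `s` is the start of the run of steps up to `k` that use the same factor; at that moment the
  -- normal form does not begin with this factor, so the whole run amounts to one new syllable `m`.
  have key : ∀ k < n, ∃ s ≤ k, (∀ t, s ≤ t → t ≤ k → idx t = idx k) ∧
      (Word.equiv (w s)).fstIdx ≠ some (idx k) ∧ ∃ m : M (idx k), w (k + 1) = of m * w s := by
    intro k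
    induction k with
    | zero =>
      intro h
      exact ⟨0, le_rfl, fun t h1 h2 => by rw [Nat.le_zero.1 h2],
        by simp [h0, Word.equiv, Word.empty, Word.fstIdx], hstep 0 h⟩
    | succ k ih =>
      intro hk
      obtain ⟨s, hs, hidx, hfst, m, hm⟩ := ih (by lia)
      obtain ⟨m', hm'⟩ := hstep (k + 1) hk
      by_cases he : idx (k + 1) = idx k
      · refine ⟨s, by lia, fun t h1 h2 => ?_, he ▸ hfst, ?_⟩
        · rcases Nat.lt_or_ge k t with h | h
          · rw [show t = k + 1 by lia]
          · rw [hidx t h1 h, he]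
        · rw [hm', hm]
          clear hm'
          revert m'
          rw [he]
          exact fun m' => ⟨m' * m, by rw [map_mul, mul_assoc]⟩
      · refine ⟨k + 1, le_rfl, fun t h1 h2 => by rw [le_antisymm h2 h1], ?_, m', hm'⟩
        -- A trivial run would return to its starting value `w s`.
        have hm1 : m ≠ 1 := by
          rintro rfl
          rw [map_one, one_mul] at hm
          have := hinj _ hk s (by lia) hm
          lia
        rw [hm, fstIdx_equiv_of_mul hm1 hfst]
        simpa using fun h => he h.symm
  obtain ⟨s, hs, hidx, hfst, m, hm⟩ := key (n - 1) (by lia)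
  rw [Nat.sub_add_cancel hn, hw] at hm
  -- A last run starting after time `0` either repeats the value `1` or leaves a nonempty normal
  -- form.
  have hs0 : s = 0 := by
    by_contra hne
    by_cases hm1 : m = 1
    · rw [hm1, map_one, one_mul, ← h0] at hm
      exact hne (hinj 0 hn s (by lia) hm).symm
    · have := fstIdx_equiv_of_mul hm1 hfst
      rw [← hm] at this
      simp [Word.equiv, Word.empty, Word.fstIdx] at this
  subst hs0
  intro k hk
  rw [hidx k (by lia) (by lia), hidx 0 le_rfl (by lia)]

end Truncation

end

/-! ### Superposing blocks along the cosets of a finite group -/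

section

open SimpleGraph Monoid

theorem exists_coset_rep {A P : Type*} [Group A] [Group P] (f : A →* P) :
    ∃ r : P → P, (∀ m u, r (f m * u) = r u) ∧ ∀ u, ∃ m, u = f m * r u := by
  let q : P → Quotient (QuotientGroup.rightRel f.range) := Quotient.mk _
  refine ⟨fun u => (q u).out, fun m u => ?_, fun u => ?_⟩
  · have : q (f m * u) = q u := Quotient.sound (by
      change QuotientGroup.rightRel f.range _ _
      rw [QuotientGroup.rightRel_apply]
      exact ⟨m⁻¹, by simp⟩)
    simp only [this]
  · have : QuotientGroup.rightRel f.range (q u).out u := Quotient.mk_out u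
    rw [QuotientGroup.rightRel_apply] at this
    obtain ⟨m, hm⟩ := this
    exact ⟨m, by rw [hm]; simp⟩

section CosetGraph

variable {A P : Type*} [Group A] [Group P]

/-- A representative of the right coset of `u` by the image of `f`. -/
noncomputable def cosetRep (f : A →* P) : P → P := (exists_coset_rep f).choose

theorem cosetRep_mul (f : A →* P) (m : A) (u : P) : cosetRep f (f m * u) = cosetRep f u :=
  (exists_coset_rep f).choose_spec.1 m u

theorem exists_eq_mul_cosetRep (f : A →* P) (u : P) : ∃ m, u = f m * cosetRep f u :=
  (exists_coset_rep f).choose_spec.2 u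

theorem cosetRep_cosetRep (f : A →* P) (u : P) : cosetRep f (cosetRep f u) = cosetRep f u := by
  obtain ⟨m, hm⟩ := exists_eq_mul_cosetRep f u
  conv_rhs => rw [hm, cosetRep_mul]

/-- A disjoint union of copies of a graph on `A`, whose vertex sets are the right cosets of the
image of `A` in `P`. -/
def cosetGraph (f : A →* P) (hf : Function.Injective f) (G : SimpleGraph A) : SimpleGraph P where
  Adj u v := ∃ a b, G.Adj a b ∧ u = f a * cosetRep f u ∧ v = f b * cosetRep f u
  symm := ⟨fun u v ⟨a, b, h, hu, hv⟩ => by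
    have : cosetRep f v = cosetRep f u := by
      conv_lhs => rw [hv, cosetRep_mul, cosetRep_cosetRep]
    exact ⟨b, a, h.symm, by rw [this]; exact hv, by rw [this]; exact hu⟩⟩
  loopless := ⟨fun u ⟨a, b, h, hu, hv⟩ => h.ne (hf (mul_right_cancel (hu.symm.trans hv)))⟩

variable {f : A →* P} {hf : Function.Injective f} {G : SimpleGraph A}

theorem cosetGraph_adj_iff (u : P) (a : A) (w : P) :
    (cosetGraph f hf G).Adj (f a * cosetRep f u) w ↔ ∃ b, G.Adj a b ∧ w = f b * cosetRep f u := by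
  have hr : cosetRep f (f a * cosetRep f u) = cosetRep f u := by
    rw [cosetRep_mul, cosetRep_cosetRep]
  constructor
  · rintro ⟨a', b, h, hu, hw⟩
    rw [hr] at hu hw
    rw [← hf (mul_right_cancel hu)] at h
    exact ⟨b, h, hw⟩
  · rintro ⟨b, h, rfl⟩
    exact ⟨a, b, h, by rw [hr], by rw [hr]⟩

/-- Edges of block `i` are left multiplications by elements of factor `i`, so walks in the union
become words in the free product. -/
theorem exists_of_cosetGraph_adj {u v : P} (h : (cosetGraph f hf G).Adj u v) :
    ∃ m, v = f m * u := by
  obtain ⟨a, b, -, hu, hv⟩ := h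
  refine ⟨b * a⁻¹, ?_⟩
  have : cosetRep f u = (f a)⁻¹ * u := eq_inv_mul_of_mul_eq hu.symm
  rw [hv, this, map_mul, map_inv, mul_assoc]

theorem IsBlock.cosetGraph {g d l : ℕ} (hG : IsBlock G g d l) :
    IsBlock (cosetGraph f hf G) g d l := by
  have hinj : ∀ u : P, Function.Injective fun a => f a * cosetRep f u :=
    fun u a b h => hf (mul_right_cancel h)
  refine ⟨fun u => ?_, fun n p hp => ?_, fun u => ?_⟩
  · obtain ⟨a, ha⟩ := exists_eq_mul_cosetRep f u
    rw [ha, ← hG.regular a]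
    exact ncard_neighborSet_of_component (hinj u) (cosetGraph_adj_iff u) a
  · obtain ⟨a, ha⟩ := exists_eq_mul_cosetRep f (p 0)
    obtain ⟨q, hq, -⟩ := hp.exists_lift_of_component (hinj (p 0)) (cosetGraph_adj_iff (p 0)) ha
    exact hG.girth n q hq
  · obtain ⟨a, ha⟩ := exists_eq_mul_cosetRep f u
    rw [ha, ← hG.cycles a]
    exact ncard_cycSets_of_component (hinj u) (cosetGraph_adj_iff u) g a

end CosetGraph

theorem isBlock_iSup {ι V : Type*} [Fintype ι] [Finite V] {C : ι → SimpleGraph V} {g : ℕ}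
    {d l : ι → ℕ} (hC : ∀ i, IsBlock (C i) g (d i) (l i))
    (hdisj : ∀ i j u v, (C i).Adj u v → (C j).Adj u v → i = j)
    (hcyc : ∀ n p, n ≤ g → IsCyc (⨆ i, C i) n p → ∃ i, IsCyc (C i) n p) :
    IsBlock (⨆ i, C i) g (∑ i, d i) (∑ i, l i) := by
  refine ⟨fun u => ?_, fun n p hp => ?_, fun u => ?_⟩
  · have : (⨆ i, C i).neighborSet u = ⋃ i, (C i).neighborSet u := by
      ext v; simp
    rw [this, Set.ncard_iUnion_of_finite fun i => Set.toFinite _, finsum_eq_sum_of_fintype]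
    · exact Finset.sum_congr rfl fun i _ => (hC i).regular u
    · exact fun i j hij => Set.disjoint_left.2 fun v h h' => hij (hdisj i j u v h h')
  · by_contra! hn
    obtain ⟨i, hi⟩ := hcyc n p hn.le hp
    exact absurd ((hC i).girth n p hi) (by lia)
  · have : cycSets (⨆ i, C i) g u = ⋃ i, cycSets (C i) g u := by
      refine subset_antisymm ?_ (Set.iUnion_subset fun i => cycSets_mono (le_iSup C i) g u)
      rintro E ⟨p, hp, h0, rfl⟩
      obtain ⟨i, hi⟩ := hcyc g p le_rfl hp
      exact Set.mem_iUnion.2 ⟨i, p, hi, h0, rfl⟩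
    rw [this, Set.ncard_iUnion_of_finite fun i => Set.toFinite _, finsum_eq_sum_of_fintype]
    · exact Finset.sum_congr rfl fun i _ => (hC i).cycles u
    · refine fun i j hij => Set.disjoint_left.2 ?_
      rintro _ ⟨p, hp, -, rfl⟩ ⟨q, hq, -, he⟩
      have h0 : 0 < g := by have := hp.three_le; lia
      have : s(p 0, p 1) ∈ stepEdges g q := by rw [← he]; exact ⟨0, h0, rfl⟩
      obtain ⟨k, hk, hk'⟩ := this
      have h1 := hp.adj 0 h0
      have h2 := hq.adj k hk
      rw [← mem_edgeSet, ← hk', mem_edgeSet] at h2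
      exact hij (hdisj i j _ _ h1 h2)

section FreeProduct

variable {ι : Type*} {M : ι → Type*} [∀ i, Group (M i)] [DecidableEq ι] [∀ i, DecidableEq (M i)]
  {P : Type*} [Group P] {Φ : CoprodI M →* P} {N : ℕ}

theorem injective_comp_of (hΦ : ∀ x, syllables x ≤ N + 2 → Φ x = 1 → x = 1) (i : ι) :
    Function.Injective (Φ.comp (CoprodI.of : M i →* CoprodI M)) := by
  rw [injective_iff_map_eq_one]
  intro m hm
  have h1 : syllables (CoprodI.of m * (1 : CoprodI M)) ≤ 0 + 1 := by
    rw [← syllables_one (M := M)]; exact syllables_of_mul_le m 1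
  rw [mul_one] at h1
  have := hΦ (CoprodI.of m) (by lia) hm
  exact CoprodI.of_injective i (by rw [this, map_one])

/-- After `n` steps the lifted sequence has at most `n` syllables, so closing up in `P` forces
closing up in the free product. -/
theorem idx_eq_of_closed_of_quotient (hΦ : ∀ x, syllables x ≤ N + 2 → Φ x = 1 → x = 1) {n : ℕ}
    (hn : 0 < n) (hnN : n ≤ N + 2) {p : ℕ → P} (idx : ℕ → ι)
    (hstep : ∀ k < n, ∃ m : M (idx k), p (k + 1) = Φ (CoprodI.of m) * p k) (hp : p n = p 0)
    (hinj : ∀ i < n, ∀ j < n, p i = p j → i = j) : ∀ k < n, idx k = idx 0 := by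
  have : ∀ k, ∃ m : M (idx k), k < n → p (k + 1) = Φ (CoprodI.of m) * p k := fun k => by
    by_cases hk : k < n
    · obtain ⟨m, hm⟩ := hstep k hk; exact ⟨m, fun _ => hm⟩
    · exact ⟨1, fun h => absurd h hk⟩
  choose m hm using this
  let w : ℕ → CoprodI M := fun k => Nat.rec 1 (fun k x => CoprodI.of (m k) * x) k
  have hw : ∀ k, w (k + 1) = CoprodI.of (m k) * w k := fun k => rfl
  have hpw : ∀ k ≤ n, p k = Φ (w k) * p 0 := by
    intro k
    induction k with
    | zero => intro _; change _ = Φ 1 * _; simp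
    | succ k ih => intro hk; rw [hm k hk, ih (by lia), hw, map_mul, mul_assoc]
  have hlen : ∀ k, syllables (w k) ≤ k := by
    intro k
    induction k with
    | zero => exact syllables_one.le
    | succ k ih => rw [hw]; exact (syllables_of_mul_le _ _).trans (by lia)
  refine idx_eq_of_closed hn idx (w := w) (fun k _ => ⟨m k, hw k⟩) rfl ?_ ?_
  · refine hΦ _ ((hlen n).trans hnN) ?_
    have := hpw n le_rfl
    rw [hp] at this
    exact mul_eq_right.1 this.symm
  · intro i hi j hj h
    exact hinj i hi j hj (by rw [hpw i hi.le, hpw j hj.le, h])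

end FreeProduct

/-- Blocks for the same girth can be combined, adding their degrees and their numbers of cycles. -/
theorem HasBlock.sum {ι : Type} [Fintype ι] {g : ℕ} {d l m : ι → ℕ}
    (h : ∀ i, HasBlock g (d i) (l i) (m i)) (i₀ : ι) :
    HasBlock g (∑ i, d i) (∑ i, l i) (m i₀) := by
  classical
  choose V hfin hne G hG hm using h
  -- Any group structure serves; the cyclic one exists on every finite nonempty set.
  have hgrp : ∀ i, Nonempty (Group (V i)) := fun i => by
    have : NeZero (Nat.card (V i)) := ⟨Nat.card_ne_zero.2 ⟨inferInstance, inferInstance⟩⟩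
    have e : V i ≃ Multiplicative (ZMod (Nat.card (V i))) := (Finite.equivFin _).trans
      ((Finite.equivFinOfCardEq (Nat.card_zmod _)).symm.trans Multiplicative.ofAdd)
    exact ⟨e.group⟩
  have hgrp' := fun i => (hgrp i).some
  -- The extra `2` covers embeddings of the factors and closed walks of length two, whatever `g` is.
  obtain ⟨P, _, _, Φ, hΦ⟩ := exists_finite_quotient_coprodI (M := V) (g + 2)
  have hf := fun i => injective_comp_of hΦ i
  have hidx {n : ℕ} {p : ℕ → P} (hn : 0 < n) (hng : n ≤ g + 2) (idx : ℕ → ι)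
      (hstep : ∀ k < n, (cosetGraph _ (hf (idx k)) (G (idx k))).Adj (p k) (p (k + 1)))
      (hp : p n = p 0) (hinj : ∀ i < n, ∀ j < n, p i = p j → i = j) : ∀ k < n, idx k = idx 0 :=
    idx_eq_of_closed_of_quotient hΦ hn hng idx
      (fun k hk => exists_of_cosetGraph_adj (hstep k hk)) hp hinj
  refine ⟨P, inferInstance, inferInstance, ⨆ i, cosetGraph _ (hf i) (G i),
    isBlock_iSup (fun i => (hG i).cosetGraph) ?_ ?_,
    (hm i₀).trans (Nat.card_le_card_of_injective _ (hf i₀))⟩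
  -- An edge in two blocks gives the closed sequence `u, v, u`, one step in each factor.
  · intro i j u v hi hj
    refine (hidx (n := 2) (by lia) (by lia) (p := fun k => if k % 2 = 0 then u else v)
      (fun k => if k = 0 then j else i) ?_ rfl ?_ 1 (by lia))
    · intro k hk
      interval_cases k
      · exact hj
      · exact hi.symm
    · have := hi.ne
      intro a ha b hb hab
      interval_cases a <;> interval_cases b <;> simp_all
  · intro n p hn hp
    have h3 := hp.three_le
    have : ∀ k, ∃ i, k < n → (cosetGraph _ (hf i) (G i)).Adj (p k) (p (k + 1)) := fun k => by
      by_cases hk : k < n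
      · obtain ⟨i, hi⟩ := iSup_adj.1 (hp.adj k hk); exact ⟨i, fun _ => hi⟩
      · exact ⟨i₀, fun h => absurd h hk⟩
    choose idx hi using this
    have := hidx (by lia) (by lia) idx hi hp.closed hp.inj
    exact ⟨idx 0, hp.three_le, hp.closed, fun k hk => this k hk ▸ hi k hk, hp.inj⟩

end

/-! ### The graph of a map and its faces -/

section

open SimpleGraph

/-- Elements `r` and `s` of a group that act on the darts of a map of type `{g, lam}` as the
rotation about a vertex and as the reversal, such that the only closed walks of length at most `g`
without backtracking are the boundaries of faces. -/
structure IsMapPair {P : Type*} [Group P] (r s : P) (g lam : ℕ) : Prop where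
  three_le_lam : 3 ≤ lam
  three_le_g : 3 ≤ g
  r_pow : r ^ lam = 1
  s_mul : s * s = 1
  rs_pow : (r * s) ^ g = 1
  words : ∀ l : List ℕ, l ≠ [] → l.length ≤ g → (∀ j ∈ l, 0 < j ∧ j < lam) →
    (l.map fun j => r ^ j * s).prod = 1 → l.length = g ∧ ((∀ j ∈ l, j = 1) ∨ ∀ j ∈ l, j + 1 = lam)

namespace IsMapPair

variable {P : Type*} [Group P] {r s : P} {g lam : ℕ} (h : IsMapPair r s g lam)

include h

theorem s_inv : s⁻¹ = s := inv_eq_of_mul_eq_one_left h.s_mul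

theorem r_pow_ne_one {j : ℕ} (h0 : 0 < j) (hj : j < lam) : r ^ j ≠ 1 := by
  intro hr
  have h3 := h.three_le_g
  have hr' : r ^ (lam - j) = 1 := by rw [pow_sub _ hj.le, h.r_pow, hr]; simp
  have := (h.words [j, lam - j] (by simp) (by simp; lia) (by simp; lia)
    (by simp [hr, hr', h.s_mul])).1
  simp at this
  lia

theorem orderOf_r : orderOf r = lam := by
  have h3 := h.three_le_lam
  refine (orderOf_eq_iff (by lia)).2 ⟨h.r_pow, fun m hm h0 => h.r_pow_ne_one h0 hm⟩

theorem exists_pow_of_mem {x : P} (hx : x ∈ Subgroup.zpowers r) : ∃ j < lam, x = r ^ j := by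
  have h3 := h.three_le_lam
  obtain ⟨z, rfl⟩ := hx
  have hlam : (0 : ℤ) < lam := by lia
  refine ⟨(z % lam).toNat, by have := Int.emod_lt_of_pos z hlam; lia, ?_⟩
  have := Int.emod_nonneg z hlam.ne'
  rw [← zpow_natCast, Int.toNat_of_nonneg this, ← h.orderOf_r, zpow_mod_orderOf]

theorem exists_eq_mul_pow {x y : P}
    (hxy : (x : P ⧸ Subgroup.zpowers r) = (y : P ⧸ Subgroup.zpowers r)) :
    ∃ j < lam, y = x * r ^ j := by
  obtain ⟨j, hj, e⟩ := h.exists_pow_of_mem (QuotientGroup.eq.1 hxy)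
  exact ⟨j, hj, by rw [← e]; group⟩

theorem mk_ne_mk_mul (x : P) :
    (x : P ⧸ Subgroup.zpowers r) ≠ ((x * s : P) : P ⧸ Subgroup.zpowers r) := by
  intro hx
  have h3 := h.three_le_g
  have h3' := h.three_le_lam
  obtain ⟨j, hj, e⟩ := h.exists_eq_mul_pow hx
  have e : s = r ^ j := mul_left_cancel e
  rcases Nat.eq_zero_or_pos j with rfl | h0
  · have hr : r * s * (r ^ (lam - 1) * s) = 1 := by
      rw [e, pow_zero, mul_one, mul_one, ← pow_succ', Nat.sub_add_cancel (by lia), h.r_pow]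
    have := (h.words [1, lam - 1] (by simp) (by simp; lia) (by simp; lia) (by simpa using hr)).1
    simp at this
    lia
  · have hr : r ^ (lam - j) * s = 1 := by
      rw [e, ← pow_add, Nat.sub_add_cancel hj.le, h.r_pow]
    have := (h.words [lam - j] (by simp) (by simp; lia) (by simp; lia) (by simpa using hr)).1
    simp at this
    lia

/-- Two darts with the same ends would yield a trivial word of length one or two, or a trivial power
of `r`. Hence the map has no multiple edges. -/
theorem dart_ext {x y : P}
    (h1 : (x : P ⧸ Subgroup.zpowers r) = (y : P ⧸ Subgroup.zpowers r))
    (h2 : ((x * s : P) : P ⧸ Subgroup.zpowers r) = ((y * s : P) : P ⧸ Subgroup.zpowers r)) :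
    x = y := by
  have h3 := h.three_le_g
  obtain ⟨j, hj, rfl⟩ := h.exists_eq_mul_pow h1
  obtain ⟨k, hk, e⟩ := h.exists_eq_mul_pow h2
  rw [mul_assoc, mul_assoc] at e
  have e : r ^ j * s = s * r ^ k := mul_left_cancel e
  rcases Nat.eq_zero_or_pos j with rfl | h0
  · simp
  exfalso
  rcases Nat.eq_zero_or_pos k with rfl | hk0
  · rw [pow_zero, mul_one] at e
    exact h.r_pow_ne_one h0 hj (mul_eq_right.1 e)
  · have hr : r ^ j * s * (r ^ (lam - k) * s) = 1 := by
      rw [e, mul_assoc, ← mul_assoc (r ^ k), ← pow_add, Nat.add_sub_cancel' hk.le, h.r_pow, one_mul,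
        h.s_mul]
    have := (h.words [j, lam - k] (by simp) (by simp; lia) (by simp; lia) (by simpa using hr)).1
    simp at this
    lia

end IsMapPair

section MapGraph

variable {P : Type*} [Group P]

/-- The underlying graph of the map with dart set `P`, whose vertices are the orbits of the
rotation `r` and whose edges are given by the involution `s`. -/
def mapGraph {r s : P} {g lam : ℕ} (h : IsMapPair r s g lam) :
    SimpleGraph (P ⧸ Subgroup.zpowers r) where
  Adj u v := ∃ x : P, (x : P ⧸ Subgroup.zpowers r) = u ∧ ((x * s : P) : P ⧸ Subgroup.zpowers r) = v
  symm := ⟨fun u v ⟨x, hu, hv⟩ => ⟨x * s, hv, by rw [mul_assoc, h.s_mul, mul_one, hu]⟩⟩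
  loopless := ⟨fun u ⟨x, hu, hv⟩ => h.mk_ne_mk_mul x (hu.trans hv.symm)⟩

/-- The edge underlying a dart. -/
def dartEdge (r s x : P) : Sym2 (P ⧸ Subgroup.zpowers r) :=
  s((x : P ⧸ Subgroup.zpowers r), ((x * s : P) : P ⧸ Subgroup.zpowers r))

/-- The edges on the boundary of the face at a dart. -/
def faceEdges (r s x : P) : Set (Sym2 (P ⧸ Subgroup.zpowers r)) :=
  {e | ∃ z : ℤ, e = dartEdge r s (x * (s * r) ^ z)}

theorem mk_mul_r (r x : P) :
    ((x * r : P) : P ⧸ Subgroup.zpowers r) = (x : P ⧸ Subgroup.zpowers r) :=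
  QuotientGroup.mk_mul_of_mem x (Subgroup.mem_zpowers r)

variable {r s : P} {g lam : ℕ} (h : IsMapPair r s g lam)

theorem prod_map_mul_comm (l : List ℕ) :
    (l.map fun j => s * r ^ j).prod * s = s * (l.map fun j => r ^ j * s).prod := by
  induction l with
  | nil => simp
  | cons a l ih => simp only [List.map_cons, List.prod_cons, mul_assoc, ih]

theorem mk_pow_succ (x : P) (k : ℕ) :
    ((x * (s * r) ^ (k + 1) : P) : P ⧸ Subgroup.zpowers r) =
      ((x * (s * r) ^ k * s : P) : P ⧸ Subgroup.zpowers r) := by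
  rw [pow_succ, ← mul_assoc, ← mul_assoc, mk_mul_r]

theorem stepEdges_eq_of_darts {p : ℕ → P ⧸ Subgroup.zpowers r} {y : ℕ → P}
    (hy : ∀ k < g, (y k : P ⧸ Subgroup.zpowers r) = p k ∧
      ((y k * s : P) : P ⧸ Subgroup.zpowers r) = p (k + 1)) :
    stepEdges g p = {e | ∃ k < g, e = dartEdge r s (y k)} := by
  ext e
  constructor <;> rintro ⟨k, hk, rfl⟩ <;> refine ⟨k, hk, ?_⟩ <;>
    rw [dartEdge, (hy k hk).1, (hy k hk).2]

include h

theorem IsMapPair.sr_pow : (s * r) ^ g = 1 := by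
  have : s * r = s * (r * s) * s⁻¹ := by group
  rw [this, conj_pow, h.rs_pow]
  group

theorem IsMapPair.exists_pow_lt (z : ℤ) : ∃ k < g, (s * r) ^ z = (s * r) ^ k := by
  have h3 := h.three_le_g
  have hg : (0 : ℤ) < g := by lia
  refine ⟨(z % g).toNat, by have := Int.emod_lt_of_pos z hg; lia, ?_⟩
  have := Int.emod_nonneg z hg.ne'
  rw [← zpow_natCast, Int.toNat_of_nonneg this]
  conv_lhs => rw [← Int.emod_add_mul_ediv z g, zpow_add, zpow_mul, zpow_natCast, h.sr_pow, one_zpow,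
    mul_one]

theorem dartEdge_mul_s (x : P) : dartEdge r s (x * s) = dartEdge r s x := by
  rw [dartEdge, mul_assoc, h.s_mul, mul_one, dartEdge, Sym2.eq_swap]

/-- The darts of a cycle, each obtained from the previous one by a turn. -/
theorem exists_darts_of_isCyc {n : ℕ} {p : ℕ → P ⧸ Subgroup.zpowers r}
    (hp : IsCyc (mapGraph h) n p) :
    ∃ (y : ℕ → P) (j : ℕ → ℕ), (∀ k < n, (y k : P ⧸ Subgroup.zpowers r) = p k ∧
      ((y k * s : P) : P ⧸ Subgroup.zpowers r) = p (k + 1)) ∧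
      (∀ k, y (k + 1) = y k * (s * r ^ j k) ∧ 0 < j k ∧ j k < lam) ∧ y n = y 0 := by
  have h3 := hp.three_le
  have hn : 0 < n := by lia
  have hq : ∀ k, ∃ x : P, (x : P ⧸ Subgroup.zpowers r) = p (k % n) ∧
      ((x * s : P) : P ⧸ Subgroup.zpowers r) = p (k % n + 1) :=
    fun k => hp.adj _ (Nat.mod_lt k hn)
  choose x hx1 hx2 using hq
  have hper : ∀ k, p (k % n + 1) = p ((k + 1) % n) := fun k => by
    have := Nat.mod_lt k hn
    rcases Nat.lt_or_ge (k % n + 1) n with h1 | h1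
    · rw [← Nat.mod_eq_of_lt h1, Nat.mod_add_mod]
    · have h2 : k % n + 1 = n := by lia
      have : (k + 1) % n = 0 := by rw [← Nat.mod_add_mod, h2, Nat.mod_self]
      rw [this, h2, hp.closed]
  have hx0 : ∀ k, x k = x (k % n) := fun k => h.dart_ext
    (by rw [hx1, hx1, Nat.mod_mod]) (by rw [hx2, hx2, Nat.mod_mod])
  have hj : ∀ k, ∃ j, x (k + 1) = x k * (s * r ^ j) ∧ 0 < j ∧ j < lam := fun k => by
    obtain ⟨j, hj, e⟩ := h.exists_eq_mul_pow ((hx2 k).trans ((hper k).trans (hx1 (k + 1)).symm))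
    -- With `j = 0` the walk would turn back along the dart just used and meet the same vertex two
    -- steps apart, which is impossible as `n ≥ 3`.
    refine ⟨j, by rw [e, mul_assoc], Nat.pos_of_ne_zero ?_, hj⟩
    rintro rfl
    rw [pow_zero, mul_one] at e
    have h2 := hx2 (k + 1)
    rw [e, mul_assoc, h.s_mul, mul_one, hx1, hper] at h2
    have := hp.inj _ (Nat.mod_lt _ hn) _ (Nat.mod_lt _ hn) h2
    have h4 : k ≡ k + 2 [MOD n] := this
    have := Nat.le_of_dvd (by lia)
      ((Nat.modEq_zero_iff_dvd).1 (Nat.ModEq.add_left_cancel' (c := k) (b := 0) h4.symm))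
    lia
  choose j hj using hj
  refine ⟨x, j, fun k hk => ?_, hj, by rw [hx0 n, Nat.mod_self]⟩
  have := hx1 k
  have h2 := hx2 k
  rw [Nat.mod_eq_of_lt hk] at this h2
  exact ⟨this, h2⟩

/-- The turns of a closed walk spell a product of the `s * r ^ j` equal to `1`. Conjugation by `s`
makes it one of the words restricted by `IsMapPair`. -/
theorem length_eq_of_isCyc {n : ℕ} {y : ℕ → P} {j : ℕ → ℕ} (hn : 0 < n) (hng : n ≤ g)
    (hy : ∀ k, y (k + 1) = y k * (s * r ^ j k) ∧ 0 < j k ∧ j k < lam) (hyn : y n = y 0) :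
    n = g ∧ ((∀ k < n, j k = 1) ∨ ∀ k < n, j k + 1 = lam) := by
  have hprod : ∀ k, y k = y 0 * (((List.range k).map j).map fun i => s * r ^ i).prod := by
    intro k
    induction k with
    | zero => simp
    | succ k ih => rw [(hy k).1, ih, List.range_succ]; simp [mul_assoc]
  have h1 := hprod n
  rw [hyn] at h1
  have h2 := prod_map_mul_comm (r := r) (s := s) ((List.range n).map j)
  rw [mul_eq_left.1 h1.symm, one_mul] at h2
  have := h.words ((List.range n).map j) (by simp; lia) (by simpa using hng)
    (by simpa using fun k _ => (hy k).2) (mul_eq_left.1 h2.symm)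
  simpa using this

theorem mapGraph_girth {n : ℕ} {p : ℕ → P ⧸ Subgroup.zpowers r} (hp : IsCyc (mapGraph h) n p) :
    g ≤ n := by
  by_contra! hn
  obtain ⟨y, j, -, hj, hy⟩ := exists_darts_of_isCyc h hp
  have := (length_eq_of_isCyc h (by have := hp.three_le; lia) hn.le hj hy).1
  lia

theorem mapGraph_adj (x : P) : (mapGraph h).Adj (x : P ⧸ Subgroup.zpowers r)
    ((x * s : P) : P ⧸ Subgroup.zpowers r) := ⟨x, rfl, rfl⟩

/-- The first early return of a face boundary to a vertex would bound a cycle shorter than `g`;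
returns after one or two steps give a loop or `r = 1`. -/
theorem face_closed_ne (m : ℕ) (h0 : 0 < m) (hm : m < g) (x : P) :
    (x : P ⧸ Subgroup.zpowers r) ≠ ((x * (s * r) ^ m : P) : P ⧸ Subgroup.zpowers r) := by
  induction m using Nat.strong_induction_on generalizing x with
  | _ m ih =>
    intro hx
    have h3 := h.three_le_lam
    rcases Nat.lt_or_ge 2 m with h2 | h2
    · have := mapGraph_girth h (n := m)
        (p := fun k => ((x * (s * r) ^ k : P) : P ⧸ Subgroup.zpowers r))
        ⟨h2, by simpa using hx.symm, fun k _ => by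
          rw [mk_pow_succ]; exact mapGraph_adj h _, fun i hi j hj hij => ?_⟩
      · lia
      have key : ∀ i j, i < j → j < m →
          ((x * (s * r) ^ i : P) : P ⧸ Subgroup.zpowers r) ≠
            ((x * (s * r) ^ j : P) : P ⧸ Subgroup.zpowers r) := fun i j h1 h2 => by
        have := ih (j - i) (by lia) (by lia) (by lia) (x * (s * r) ^ i)
        rwa [mul_assoc, ← pow_add, Nat.add_sub_cancel' h1.le] at this
      rcases lt_trichotomy i j with h1 | h1 | h1
      · exact absurd hij (key i j h1 hj)
      · exact h1
      · exact absurd hij.symm (key j i h1 hi)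
    · interval_cases m
      · rw [mk_pow_succ, pow_zero, mul_one] at hx
        exact h.mk_ne_mk_mul x hx
      · rw [mk_pow_succ, pow_one] at hx
        have e : x * (s * r) = x * s := h.dart_ext (by rw [← mul_assoc, mk_mul_r])
          (by rw [← hx, mul_assoc, h.s_mul, mul_one])
        rw [← mul_assoc, mul_eq_left] at e
        exact h.r_pow_ne_one (j := 1) (by lia) (by lia) (by simpa using e)

theorem isCyc_face (x : P) : IsCyc (mapGraph h) g
    fun k => ((x * (s * r) ^ k : P) : P ⧸ Subgroup.zpowers r) where
  three_le := h.three_le_g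
  closed := by simp [h.sr_pow]
  adj k _ := by rw [mk_pow_succ]; exact mapGraph_adj h _
  inj i hi j hj hij := by
    have key : ∀ i j, i < j → j < g →
        ((x * (s * r) ^ i : P) : P ⧸ Subgroup.zpowers r) ≠
          ((x * (s * r) ^ j : P) : P ⧸ Subgroup.zpowers r) := fun i j h1 h2 => by
      have := face_closed_ne h (j - i) (by lia) (by lia) (x * (s * r) ^ i)
      rwa [mul_assoc, ← pow_add, Nat.add_sub_cancel' h1.le] at this
    rcases lt_trichotomy i j with h1 | h1 | h1
    · exact absurd hij (key i j h1 hj)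
    · exact h1
    · exact absurd hij.symm (key j i h1 hi)

theorem stepEdges_face (x : P) :
    stepEdges g (fun k => ((x * (s * r) ^ k : P) : P ⧸ Subgroup.zpowers r)) = faceEdges r s x := by
  ext e
  constructor
  · rintro ⟨k, hk, rfl⟩
    refine ⟨k, ?_⟩
    beta_reduce
    rw [mk_pow_succ, dartEdge, zpow_natCast]
  · rintro ⟨z, rfl⟩
    obtain ⟨k, hk, e⟩ := h.exists_pow_lt z
    refine ⟨k, hk, ?_⟩
    beta_reduce
    rw [mk_pow_succ, dartEdge, e]

theorem cycSets_mapGraph (u : P ⧸ Subgroup.zpowers r) :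
    cycSets (mapGraph h) g u =
      faceEdges r s '' {x | (x : P ⧸ Subgroup.zpowers r) = u} := by
  ext E
  constructor
  · rintro ⟨p, hp, rfl, rfl⟩
    obtain ⟨y, j, hy, hj, hyn⟩ := exists_darts_of_isCyc h hp
    have h3 := hp.three_le
    have h3' := h.three_le_lam
    rw [stepEdges_eq_of_darts hy]
    rcases (length_eq_of_isCyc h (by lia) le_rfl hj hyn).2 with h1 | h1
    · refine ⟨y 0, (hy 0 (by lia)).1, ?_⟩
      have hyk : ∀ k ≤ g, y k = y 0 * (s * r) ^ k := by
        intro k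
        induction k with
        | zero => simp
        | succ k ih =>
          intro hk
          rw [(hj k).1, ih (by lia), h1 k hk, pow_one, pow_succ, mul_assoc]
      ext e
      constructor
      · rintro ⟨z, rfl⟩
        obtain ⟨k, hk, e⟩ := h.exists_pow_lt z
        exact ⟨k, hk, by rw [e, hyk k hk.le]⟩
      · rintro ⟨k, hk, rfl⟩
        exact ⟨k, by rw [hyk k hk.le, zpow_natCast]⟩
    -- Turning by `r ^ (lam - 1) = r⁻¹` throughout runs backwards along the face on the other side
    -- of `y 0`, which is the face at `y 0 * r`.
    · refine ⟨y 0 * r, by rw [← (hy 0 (by lia)).1]; exact mk_mul_r r _, ?_⟩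
      have hyk : ∀ k ≤ g, y k * s = y 0 * r * (s * r) ^ (-(k + 1) : ℤ) := by
        intro k
        induction k with
        | zero => intro _; simp [h.s_inv, mul_assoc]
        | succ k ih =>
          intro hk
          have hr : r ^ j k = r⁻¹ := by
            rw [eq_inv_iff_mul_eq_one, ← pow_succ, h1 k hk, h.r_pow]
          rw [(hj k).1, ← mul_assoc, ih (by lia), hr]
          have : (-((k + 1 : ℕ) + 1) : ℤ) = -(k + 1) + -1 := by push_cast; ring
          rw [this, zpow_add _ (-(k + 1 : ℤ)), zpow_neg_one, mul_inv_rev, h.s_inv]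
          simp only [mul_assoc]
      ext e
      constructor
      · rintro ⟨z, rfl⟩
        obtain ⟨k, hk, e⟩ := h.exists_pow_lt (-z - 1)
        refine ⟨k, hk, ?_⟩
        rw [← dartEdge_mul_s h (y k), hyk k hk.le, neg_add, zpow_add, zpow_neg, zpow_natCast, ← e,
          ← zpow_neg, ← zpow_add]
        congr 3
        ring
      · rintro ⟨k, hk, rfl⟩
        exact ⟨_, by rw [← dartEdge_mul_s h (y k), hyk k hk.le]⟩
  · rintro ⟨x, rfl, rfl⟩
    exact ⟨_, isCyc_face h x, by simp, (stepEdges_face h x).symm⟩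

theorem dart_of_dartEdge_eq {x y : P}
    (h1 : (x : P ⧸ Subgroup.zpowers r) = (y : P ⧸ Subgroup.zpowers r))
    (h2 : dartEdge r s x = dartEdge r s y) : x = y := by
  rw [dartEdge, dartEdge, h1, Sym2.congr_right] at h2
  exact h.dart_ext h1 h2

/-- A face visits the vertex of `y` once, leaving along `y` and arriving along the edge of `y *
r⁻¹`. For `lam ≥ 3` this makes the faces at different darts of a vertex distinct. -/
theorem dart_of_mem_faceEdges {x y : P}
    (h1 : (x : P ⧸ Subgroup.zpowers r) = (y : P ⧸ Subgroup.zpowers r))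
    (h2 : dartEdge r s x ∈ faceEdges r s y) : x = y ∨ x * r = y := by
  have h3 := h.three_le_g
  rw [← stepEdges_face h] at h2
  obtain ⟨k, hk, e⟩ := h2
  have hmem : (y : P ⧸ Subgroup.zpowers r) ∈ dartEdge r s x := by
    rw [← h1]; exact Sym2.mem_mk_left _ _
  have hc := isCyc_face h y
  have h0 : (fun k => ((y * (s * r) ^ k : P) : P ⧸ Subgroup.zpowers r)) 0 =
    (y : P ⧸ Subgroup.zpowers r) := by simp
  rw [e, Sym2.mem_iff] at hmem
  rcases hmem with hm | hm
  · have := hc.inj 0 (by lia) k hk (h0.trans hm)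
    subst this
    left
    refine dart_of_dartEdge_eq h h1 (e.trans ?_)
    beta_reduce
    rw [zero_add, pow_zero, pow_one, mul_one, ← mul_assoc, mk_mul_r, dartEdge]
  · rcases Nat.lt_or_ge (k + 1) g with hk' | hk'
    · have := hc.inj 0 (by lia) (k + 1) hk' (h0.trans hm)
      lia
    · right
      have hk1 : k + 1 = g := by lia
      have hinv : (s * r) ^ k = r⁻¹ * s := by
        rw [← mul_left_inj (s * r), ← pow_succ, hk1, h.sr_pow]
        simp [mul_assoc, ← mul_assoc s s, h.s_mul]
      have hmk : ((y * r⁻¹ : P) : P ⧸ Subgroup.zpowers r) = (y : P ⧸ Subgroup.zpowers r) := by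
        rw [← mk_mul_r r (y * r⁻¹)]; simp
      have : x = y * r⁻¹ := by
        refine dart_of_dartEdge_eq h (h1.trans hmk.symm) (e.trans ?_)
        beta_reduce
        rw [hk1, h.sr_pow, hinv, mul_one, dartEdge, hmk, Sym2.eq_swap, mul_assoc]
      rw [this]
      simp

theorem ncard_fiber_image {α : Type*} (f : P → α) (x : P)
    (hf : ∀ y z : P, (y : P ⧸ Subgroup.zpowers r) = (x : P ⧸ Subgroup.zpowers r) →
      (z : P ⧸ Subgroup.zpowers r) = (x : P ⧸ Subgroup.zpowers r) → f y = f z → y = z) :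
    (f '' {y | (y : P ⧸ Subgroup.zpowers r) = (x : P ⧸ Subgroup.zpowers r)}).ncard = lam := by
  have : {y : P | (y : P ⧸ Subgroup.zpowers r) = (x : P ⧸ Subgroup.zpowers r)} =
      (fun j => x * r ^ j) '' (Finset.range lam : Set ℕ) := by
    ext y
    constructor
    · intro hy
      obtain ⟨j, hj, rfl⟩ := h.exists_eq_mul_pow (Eq.symm hy)
      exact ⟨j, by simpa using hj, rfl⟩
    · rintro ⟨j, -, rfl⟩
      exact QuotientGroup.mk_mul_of_mem x (pow_mem (Subgroup.mem_zpowers r) j)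
  rw [Set.InjOn.ncard_image (s := {y | _}) fun y hy z hz => hf y z hy hz, this,
    Set.InjOn.ncard_image, Set.ncard_coe_finset, Finset.card_range]
  intro i hi j hj hij
  refine pow_injOn_Iio_orderOf ?_ ?_ (mul_left_cancel hij) <;> rw [h.orderOf_r]
  · simpa using hi
  · simpa using hj

theorem isBlock_mapGraph : IsBlock (mapGraph h) g lam lam := by
  refine ⟨fun u => ?_, fun n p hp => mapGraph_girth h hp, fun u => ?_⟩
  · obtain ⟨x, rfl⟩ := QuotientGroup.mk_surjective u
    exact ncard_fiber_image h (fun y => ((y * s : P) : P ⧸ Subgroup.zpowers r)) x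
      fun y z hy hz hyz => h.dart_ext (hy.trans hz.symm) hyz
  · obtain ⟨x, rfl⟩ := QuotientGroup.mk_surjective u
    rw [cycSets_mapGraph, ncard_fiber_image h]
    intro y z hy hz hyz
    have h3 := h.three_le_lam
    have h1 := dart_of_mem_faceEdges h (hy.trans hz.symm) (hyz ▸ ⟨0, by simp⟩)
    have h2 := dart_of_mem_faceEdges h (hz.trans hy.symm) (hyz.symm ▸ ⟨0, by simp⟩)
    rcases h1 with h1 | h1
    · exact h1
    rcases h2 with h2 | h2
    · exact h2.symm
    · rw [← h1, mul_assoc, mul_eq_left, ← sq] at h2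
      exact absurd h2 (h.r_pow_ne_one (by lia) (by lia))

end MapGraph

end

/-! ### Comparison of polygonal arms under one turn and one advance -/

section

open Real

section ArmEstimates

variable {c D x X ρ R θ Ψ : ℝ} (hc : 1 ≤ c) (hD : 0 < D) (hX : 0 ≤ X) (hρ : 0 < ρ) (hR : 0 < R)
  (hρx : ρ ^ 2 = (c ^ 2 - 1) * x ^ 2 + D) (hRX : R ^ 2 = (c ^ 2 - 1) * X ^ 2 + D)

include hc hD hR hRX in
-- This bounds by `c` the derivative `(c ^ 2 - 1) * X / R` of the radius with respect to the
-- position.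
theorem mul_le_mul_radius : (c ^ 2 - 1) * X ≤ c * R := by
  have h1 : 0 ≤ c ^ 2 - 1 := by nlinarith
  refine le_of_abs_le (abs_le_of_sq_le_sq ?_ (by positivity))
  have : (c * R) ^ 2 - ((c ^ 2 - 1) * X) ^ 2 = (c ^ 2 - 1) * X ^ 2 + c ^ 2 * D := by
    rw [mul_pow, hRX]; ring
  nlinarith [mul_nonneg h1 (sq_nonneg X), mul_nonneg (sq_nonneg c) hD.le]

include hc hD hR hρx hRX in
theorem radius_sub_lt (hx : X < x) : ρ - R < c * (x - X) := by
  have h1 := mul_le_mul_radius hc hD hR hRX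
  have h2 : ρ ^ 2 < (R + c * (x - X)) ^ 2 := by
    have : (R + c * (x - X)) ^ 2 - ρ ^ 2 =
        (x - X) * (2 * (c * R - (c ^ 2 - 1) * X) + (x - X)) := by
      rw [add_sq, hρx, mul_pow, hRX]; ring
    have : 0 < (x - X) * (2 * (c * R - (c ^ 2 - 1) * X) + (x - X)) :=
      mul_pos (by linarith) (by linarith)
    linarith
  have := lt_of_pow_lt_pow_left₀ 2 (add_nonneg hR.le (mul_nonneg (by linarith) (by linarith))) h2
  linarith

include hc hD hX hρ hR hρx hRX in
-- The radius grows more slowly than `c` times the position, so even the worst direction, with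
-- cosine `-1`, cannot undo a lead in position.
theorem advance_le (hx : X ≤ x) (hcos : cos Ψ ≤ cos θ) :
    c * X + R * cos Ψ ≤ c * x + ρ * cos θ ∧
      (X < x ∨ cos Ψ < cos θ → c * X + R * cos Ψ < c * x + ρ * cos θ) := by
  have h1 : ρ * cos Ψ ≤ ρ * cos θ := mul_le_mul_of_nonneg_left hcos hρ.le
  have h2 : cos Ψ < cos θ → ρ * cos Ψ < ρ * cos θ := fun h => mul_lt_mul_of_pos_left h hρ
  have hl := neg_one_le_cos Ψ
  have hu := cos_le_one Ψ
  rcases hx.eq_or_lt with rfl | hlt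
  · have : ρ = R := by
      rw [← hRX] at hρx
      exact (pow_left_inj₀ hρ.le hR.le two_ne_zero).1 hρx
    subst this
    exact ⟨by linarith, fun h => by
      rcases h with h | h
      · exact absurd h (lt_irrefl _)
      · linarith [h2 h]⟩
  · have h3 := radius_sub_lt hc hD hR hρx hRX hlt
    have h4 : R ≤ ρ := by
      refine (pow_le_pow_iff_left₀ hR.le hρ.le two_ne_zero).1 ?_
      have : ρ ^ 2 - R ^ 2 = (c ^ 2 - 1) * (x ^ 2 - X ^ 2) := by rw [hρx, hRX]; ring
      have : 0 ≤ (c ^ 2 - 1) * (x ^ 2 - X ^ 2) :=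
        mul_nonneg (by nlinarith) (by nlinarith)
      linarith
    have h5 : -(ρ - R) ≤ (ρ - R) * cos Ψ := by nlinarith
    have h6 : c * X + R * cos Ψ < c * x + ρ * cos θ := by linarith
    exact ⟨h6.le, fun _ => h6⟩

include hc hD hX hρ hR hρx hRX in
-- Advancing keeps the normal component, so the quotients behind these products are the cotangents
-- of the new directions: the arm deviating less still deviates less after the edge.
theorem cross_nonneg (hx : X ≤ x) (h0 : 0 ≤ θ) (hθ : θ ≤ Ψ) (hΨ : Ψ ≤ π) :
    ((c ^ 2 - 1) * X + c * (R * cos Ψ)) * (ρ * sin θ) ≤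
      ((c ^ 2 - 1) * x + c * (ρ * cos θ)) * (R * sin Ψ) := by
  have h1 := mul_le_mul_radius hc hD hR hRX
  have hc2 : 0 ≤ c ^ 2 - 1 := by nlinarith
  have hs : 0 ≤ sin Ψ := sin_nonneg_of_nonneg_of_le_pi (h0.trans hθ) hΨ
  have hd : 0 ≤ sin (Ψ - θ) := sin_nonneg_of_nonneg_of_le_pi (by linarith) (by linarith)
  have hxR : X * ρ ≤ x * R := by
    refine le_of_abs_le (abs_le_of_sq_le_sq ?_ (mul_nonneg (hX.trans hx) hR.le))
    have : (x * R) ^ 2 - (X * ρ) ^ 2 = D * (x ^ 2 - X ^ 2) := by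
      rw [mul_pow, mul_pow, hρx, hRX]; ring
    have : 0 ≤ D * (x ^ 2 - X ^ 2) := mul_nonneg hD.le (by nlinarith)
    linarith
  have htri : sin θ ≤ sin Ψ + sin (Ψ - θ) := by
    have : sin θ = sin Ψ * cos (Ψ - θ) - cos Ψ * sin (Ψ - θ) := by
      rw [← sin_sub]; congr 1; ring
    rw [this]
    nlinarith [cos_le_one (Ψ - θ), neg_one_le_cos Ψ]
  have hmain : 0 ≤ (c ^ 2 - 1) * X * (sin Ψ - sin θ) + c * R * sin (Ψ - θ) := by
    have h2 : 0 ≤ (c ^ 2 - 1) * X := mul_nonneg hc2 hX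
    nlinarith
  have hprod : 0 ≤ (c ^ 2 - 1) * sin Ψ * (x * R - X * ρ) :=
    mul_nonneg (mul_nonneg hc2 hs) (by linarith)
  have key : ((c ^ 2 - 1) * x + c * (ρ * cos θ)) * (R * sin Ψ) -
      ((c ^ 2 - 1) * X + c * (R * cos Ψ)) * (ρ * sin θ) =
      (c ^ 2 - 1) * sin Ψ * (x * R - X * ρ) +
      ρ * ((c ^ 2 - 1) * X * (sin Ψ - sin θ) + c * R * sin (Ψ - θ)) := by
    rw [sin_sub]; ring
  have := mul_nonneg hρ.le hmain
  linarith

end ArmEstimates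

/-- The values of a linear functional on the position, the tangent and the normal at a vertex of a
polygonal arm in a plane of constant curvature. -/
@[ext]
structure ArmFrame where
  x : ℝ
  y : ℝ
  n : ℝ

namespace ArmFrame

/-- Turning by the angle `φ`. -/
noncomputable def turn (φ : ℝ) (v : ArmFrame) : ArmFrame :=
  ⟨v.x, v.y * cos φ - v.n * sin φ, v.y * sin φ + v.n * cos φ⟩

/-- Advancing along an edge; `c` is the hyperbolic cosine of its length. -/
def go (c : ℝ) (v : ArmFrame) : ArmFrame :=
  ⟨c * v.x + v.y, (c ^ 2 - 1) * v.x + c * v.y, v.n⟩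

/-- Turning and then advancing along an edge. -/
noncomputable def step (c φ : ℝ) (v : ArmFrame) : ArmFrame := (v.turn φ).go c

/-- The frame at the end of an arm with prescribed turns. -/
noncomputable def arm (c : ℝ) (l : List ℝ) (v : ArmFrame) : ArmFrame :=
  l.foldl (fun v φ => v.step c φ) v

/-- The length of the tangential part of a frame, as a function of its position. -/
noncomputable def rad (c D x : ℝ) : ℝ := √((c ^ 2 - 1) * x ^ 2 + D)

theorem rad_pos {c D : ℝ} (hc : 1 ≤ c) (hD : 0 < D) (x : ℝ) : 0 < rad c D x :=
  sqrt_pos.2 (add_pos_of_nonneg_of_pos (mul_nonneg (by nlinarith) (sq_nonneg x)) hD)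

theorem rad_sq {c D : ℝ} (hc : 1 ≤ c) (hD : 0 < D) (x : ℝ) :
    rad c D x ^ 2 = (c ^ 2 - 1) * x ^ 2 + D :=
  sq_sqrt (add_nonneg (mul_nonneg (by nlinarith) (sq_nonneg x)) hD.le)

/-- `v` has direction `ψ`. -/
def HasDir (c D : ℝ) (v : ArmFrame) (ψ : ℝ) : Prop :=
  v.y = rad c D v.x * cos ψ ∧ v.n = rad c D v.x * sin ψ

theorem HasDir.turn {c D : ℝ} {v : ArmFrame} {ψ : ℝ} (h : HasDir c D v ψ) (φ : ℝ) :
    HasDir c D (v.turn φ) (ψ + φ) := by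
  obtain ⟨h1, h2⟩ := h
  constructor
  · simp only [ArmFrame.turn, h1, h2, cos_add]; ring
  · simp only [ArmFrame.turn, h1, h2, sin_add]; ring

theorem exists_hasDir {c D : ℝ} (hc : 1 ≤ c) (hD : 0 < D) {v : ArmFrame}
    (hv : v.y ^ 2 + v.n ^ 2 = (c ^ 2 - 1) * v.x ^ 2 + D) :
    ∃ ψ, -π < ψ ∧ ψ ≤ π ∧ HasDir c D v ψ := by
  have hn : ‖(⟨v.y, v.n⟩ : ℂ)‖ = rad c D v.x := by
    rw [← pow_left_inj₀ (norm_nonneg _) (rad_pos hc hD _).le two_ne_zero, rad_sq hc hD,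
      Complex.sq_norm, Complex.normSq_mk, ← hv]
    ring
  refine ⟨Complex.arg ⟨v.y, v.n⟩, Complex.neg_pi_lt_arg _, Complex.arg_le_pi _, ?_, ?_⟩
  · rw [← hn, Complex.norm_mul_cos_arg]
  · rw [← hn, Complex.norm_mul_sin_arg]

theorem HasDir.sq {c D : ℝ} (hc : 1 ≤ c) (hD : 0 < D) {v : ArmFrame} {ψ : ℝ}
    (h : HasDir c D v ψ) : v.y ^ 2 + v.n ^ 2 = (c ^ 2 - 1) * v.x ^ 2 + D := by
  rw [h.1, h.2, ← rad_sq hc hD]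
  linear_combination rad c D v.x ^ 2 * (sin_sq_add_cos_sq ψ)

/-- `y` and `n` carry a factor `sinh` of the edge length, so `D` is the rescaled Minkowski norm of
the functional, which does not depend on the frame. This scaling lets `c = 1` cover the Euclidean
plane. -/
theorem go_sq {c D : ℝ} {v : ArmFrame}
    (h : v.y ^ 2 + v.n ^ 2 = (c ^ 2 - 1) * v.x ^ 2 + D) :
    (v.go c).y ^ 2 + (v.go c).n ^ 2 = (c ^ 2 - 1) * (v.go c).x ^ 2 + D := by
  simp only [go]
  linear_combination h

/-- `v` is at least as far advanced as `w`, and points in a direction at most as much deviating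
from the initial one. -/
def Dominates (c D : ℝ) (v w : ArmFrame) (ψ Ψ : ℝ) : Prop :=
  0 ≤ w.x ∧ w.x ≤ v.x ∧ |ψ| ≤ Ψ ∧ Ψ ≤ π ∧ HasDir c D v ψ ∧ HasDir c D w Ψ

section Compare

variable {c D : ℝ} (hc : 1 ≤ c) (hD : 0 < D) {v w : ArmFrame} {ψ Ψ : ℝ}

include hc hD

/-- Since `Ψ ≤ π` and `φ₀ < π`, a nonnegative normal component after the turn rules out that `Ψ +
φ₀` has passed `π`. -/
theorem Dominates.turn (h : Dominates c D v w ψ Ψ) {φ φ₀ : ℝ} (hφ : |φ| ≤ φ₀) (hπ : φ₀ < π)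
    (hN : 0 ≤ (w.turn φ₀).n) : Dominates c D (v.turn φ) (w.turn φ₀) (ψ + φ) (Ψ + φ₀) := by
  obtain ⟨h1, h2, h3, h4, h5, h6⟩ := h
  refine ⟨h1, h2, (abs_add_le _ _).trans (add_le_add h3 hφ), ?_, h5.turn φ, h6.turn φ₀⟩
  by_contra! hlt
  rw [(h6.turn φ₀).2] at hN
  have hs : 0 ≤ sin (Ψ + φ₀) := nonneg_of_mul_nonneg_right hN (rad_pos hc hD _)
  have : 0 < sin (Ψ + φ₀ - π) := sin_pos_of_pos_of_lt_pi (by linarith) (by linarith)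
  rw [sin_sub_pi] at this
  linarith

theorem Dominates.go_x (h : Dominates c D v w ψ Ψ) :
    (w.go c).x ≤ (v.go c).x ∧ (w.x < v.x ∨ |ψ| < Ψ → (w.go c).x < (v.go c).x) := by
  obtain ⟨h1, h2, h3, h4, h5, h6⟩ := h
  have hcos : cos Ψ ≤ cos ψ := by
    rw [← cos_abs ψ]; exact cos_le_cos_of_nonneg_of_le_pi (abs_nonneg _) h4 h3
  have := advance_le hc hD h1 (rad_pos hc hD v.x) (rad_pos hc hD w.x) (rad_sq hc hD _)
    (rad_sq hc hD _) h2 hcos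
  simp only [go, h5.1, h6.1]
  refine ⟨this.1, fun h => this.2 (h.imp id fun h => ?_)⟩
  rw [← cos_abs ψ]; exact cos_lt_cos_of_nonneg_of_le_pi (abs_nonneg _) h4 h

theorem Dominates.go (h : Dominates c D v w ψ Ψ) (hN : 0 < w.n) (hx : 0 ≤ (w.go c).x) :
    ∃ ψ' Ψ', Dominates c D (v.go c) (w.go c) ψ' Ψ' := by
  have hle := (h.go_x hc hD).1
  obtain ⟨h1, h2, h3, h4, h5, h6⟩ := h
  obtain ⟨ψ', hl, hu, hψ'⟩ := exists_hasDir hc hD (go_sq (h5.sq hc hD))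
  obtain ⟨Ψ', hl', hu', hΨ'⟩ := exists_hasDir hc hD (go_sq (h6.sq hc hD))
  have hρ := rad_pos hc hD (v.go c).x
  have hR := rad_pos hc hD (w.go c).x
  have hs : 0 < sin Ψ' := by
    have : (w.go c).n = w.n := rfl
    rw [hΨ'.2] at this
    exact pos_of_mul_pos_right (this ▸ hN) hR.le
  have hpos : 0 < Ψ' := by
    by_contra! h
    exact absurd (sin_nonpos_of_nonpos_of_neg_pi_le h hl'.le) (by linarith)
  have hltpi : Ψ' < π := lt_of_le_of_ne hu' (by rintro rfl; simp at hs)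
  refine ⟨ψ', Ψ', hx, hle, ?_, hu', hψ', hΨ'⟩
  by_contra! hlt
  have habs : |ψ'| ≤ π := abs_le.2 ⟨hl.le, hu⟩
  have hneg : 0 < sin (|ψ'| - Ψ') := sin_pos_of_pos_of_lt_pi (by linarith) (by linarith)
  have hcross := cross_nonneg hc hD h1 (rad_pos hc hD v.x) (rad_pos hc hD w.x) (rad_sq hc hD _)
    (rad_sq hc hD _) h2 (abs_nonneg ψ) h3 h4
  rw [cos_abs, ← h5.1, ← h6.1, ← h6.2] at hcross
  have hsin : rad c D v.x * sin |ψ| = |v.n| := by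
    rw [h5.2, abs_mul, abs_of_pos (rad_pos hc hD _), ← abs_sin_eq_sin_abs_of_abs_le_pi (h3.trans h4)]
  have hsin' : rad c D (v.go c).x * sin |ψ'| = |v.n| := by
    rw [show v.n = (v.go c).n from rfl, hψ'.2, abs_mul, abs_of_pos hρ,
      ← abs_sin_eq_sin_abs_of_abs_le_pi habs]
  have e1 : (c ^ 2 - 1) * w.x + c * w.y = rad c D (w.go c).x * cos Ψ' := hΨ'.1
  have e2 : (c ^ 2 - 1) * v.x + c * v.y = rad c D (v.go c).x * cos |ψ'| := by
    rw [cos_abs]; exact hψ'.1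
  have e3 : w.n = rad c D (w.go c).x * sin Ψ' := hΨ'.2
  rw [hsin, ← hsin', e1, e2, e3] at hcross
  rw [sin_sub] at hneg
  have := mul_pos (mul_pos hρ hR) hneg
  nlinarith

end Compare

end ArmFrame

end

/-! ### The regular polygon as extremal arm -/

section

open Real

namespace ArmFrame

/-- The frames along a regular polygon, with respect to the functional vanishing on the
perpendicular bisector of an edge. -/
noncomputable def ref (c a α t : ℝ) : ArmFrame :=
  ⟨sin ((2 * t + 1) * a) / sin a, c * (sin ((2 * t + 1) * a) / sin a) - sin ((2 * t - 1) * a) / sin a,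
    (c + 1) * sin α * cos α / (sin a * cos a) * sin (2 * t * a)⟩

/-- The angles `a` and `α` and the edge length of a regular polygon that is not spherical. -/
structure IsRegular (c a α : ℝ) : Prop where
  one_le : 1 ≤ c
  a_pos : 0 < a
  a_lt : a < π / 2
  α_pos : 0 < α
  α_lt : α < π / 2
  -- In the right triangle of face centre, vertex and edge midpoint, `cosh` of half the edge length
  -- is `cos a / sin α`.
  rel : (c + 1) * sin α ^ 2 = 2 * cos a ^ 2

namespace IsRegular

variable {c a α : ℝ} (h : IsRegular c a α)

include h

theorem sin_a : 0 < sin a := sin_pos_of_pos_of_lt_pi h.a_pos (by linarith [h.a_lt, pi_pos])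

theorem cos_a : 0 < cos a := cos_pos_of_mem_Ioo ⟨by linarith [h.a_pos, pi_pos], h.a_lt⟩

theorem sin_α : 0 < sin α := sin_pos_of_pos_of_lt_pi h.α_pos (by linarith [h.α_lt, pi_pos])

theorem cos_α : 0 < cos α := cos_pos_of_mem_Ioo ⟨by linarith [h.α_pos, pi_pos], h.α_lt⟩

theorem step_ref (t : ℝ) : (ref c a α t).step c (π - 2 * α) = ref c a α (t + 1) := by
  have hB := h.sin_a
  have hA := h.cos_a
  have hrel := h.rel
  have hcos : cos (π - 2 * α) = 2 * sin α ^ 2 - 1 := by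
    rw [cos_pi_sub, cos_two_mul, cos_sq']; ring
  have hsin : sin (π - 2 * α) = 2 * sin α * cos α := by rw [sin_pi_sub, sin_two_mul]
  have e1 : sin ((2 * t + 1) * a) = sin (2 * t * a) * cos a + cos (2 * t * a) * sin a := by
    rw [← sin_add]; congr 1; ring
  have e2 : sin ((2 * t - 1) * a) = sin (2 * t * a) * cos a - cos (2 * t * a) * sin a := by
    rw [← sin_sub]; congr 1; ring
  have e3 : sin ((2 * (t + 1) + 1) * a) =
      sin (2 * t * a) * (4 * cos a ^ 3 - 3 * cos a) +
        cos (2 * t * a) * (3 * sin a - 4 * sin a ^ 3) := by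
    rw [← cos_three_mul, ← sin_three_mul, ← sin_add]; congr 1; ring
  have e4 : sin ((2 * (t + 1) - 1) * a) = sin ((2 * t + 1) * a) := by congr 1; ring
  have e5 : sin (2 * (t + 1) * a) = sin (2 * t * a) * (2 * cos a ^ 2 - 1) +
      cos (2 * t * a) * (2 * sin a * cos a) := by
    rw [← cos_two_mul, ← sin_two_mul, ← sin_add]; congr 1; ring
  have hC : (c + 1) * sin α * cos α / (sin a * cos a) * (2 * sin α * cos α) =
      4 * cos a * cos α ^ 2 / sin a := by
    field_simp
    linear_combination (2 * cos α ^ 2) * hrel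
  have hA2 : cos a ^ 2 = 1 - sin a ^ 2 := cos_sq' a
  have hq2 : cos α ^ 2 = 1 - sin α ^ 2 := cos_sq' α
  have key : (c * (sin ((2 * t + 1) * a) / sin a) - sin ((2 * t - 1) * a) / sin a) *
      cos (π - 2 * α) - (c + 1) * sin α * cos α / (sin a * cos a) * sin (2 * t * a) *
        sin (π - 2 * α) =
      sin ((2 * (t + 1) + 1) * a) / sin a - c * (sin ((2 * t + 1) * a) / sin a) := by
    rw [hcos, hsin, e3, e1, e2]
    have : (c + 1) * sin α * cos α / (sin a * cos a) * sin (2 * t * a) * (2 * sin α * cos α) =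
        4 * cos a * cos α ^ 2 / sin a * sin (2 * t * a) := by rw [← hC]; ring
    rw [this, hq2]
    field_simp
    linear_combination (2 * sin (2 * t * a) * cos a + 2 * cos (2 * t * a) * sin a) * hrel +
      4 * sin a * cos (2 * t * a) * hA2
  ext
  · simp only [step, turn, go, ref]
    rw [key]; ring
  · simp only [step, turn, go, ref]
    rw [key, e4]; ring
  · simp only [step, turn, go, ref]
    rw [hcos, hsin, e5, e1, e2]
    field_simp
    linear_combination 2 * sin (2 * t * a) * sin α * cos α * hrel

theorem ref_zero : ref c a α 0 = ⟨1, c + 1, 0⟩ := by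
  have hB := h.sin_a
  ext <;> simp [ref, hB.ne']

theorem ref_x_pos {t : ℝ} (h0 : 0 < 2 * t + 1) (ht : (2 * t + 1) * a < π) :
    0 < (ref c a α t).x :=
  div_pos (sin_pos_of_pos_of_lt_pi (mul_pos h0 h.a_pos) ht) h.sin_a

theorem ref_n_nonneg {t : ℝ} (h0 : 0 ≤ t) (ht : 2 * t * a ≤ π) : 0 ≤ (ref c a α t).n := by
  have := h.sin_a
  have := h.cos_a
  have := h.sin_α
  have := h.cos_α
  have := h.one_le
  have : 0 ≤ sin (2 * t * a) :=
    sin_nonneg_of_nonneg_of_le_pi (mul_nonneg (by linarith) h.a_pos.le) ht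
  exact mul_nonneg (by positivity) this

theorem ref_n_pos {t : ℝ} (h0 : 0 < t) (ht : 2 * t * a < π) : 0 < (ref c a α t).n := by
  have := h.sin_a
  have := h.cos_a
  have := h.sin_α
  have := h.cos_α
  have := h.one_le
  have : 0 < sin (2 * t * a) :=
    sin_pos_of_pos_of_lt_pi (mul_pos (by linarith) h.a_pos) ht
  exact mul_pos (by positivity) this

theorem D_pos : 0 < 2 * (c + 1) := by linarith [h.one_le]

theorem turn_n (t : ℝ) : ((ref c a α t).turn (π - 2 * α)).n = (ref c a α (t + 1)).n := by
  rw [← h.step_ref]; rfl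

/-- One more edge of the arm, as long as the reference polygon is at most half traversed. -/
theorem dominates_turn {j : ℕ} {v : ArmFrame} {ψ Ψ φ : ℝ}
    (hv : Dominates c (2 * (c + 1)) v (ref c a α j) ψ Ψ) (hφ : |φ| ≤ π - 2 * α)
    (hj : 2 * ((j : ℝ) + 1) * a ≤ π) :
    Dominates c (2 * (c + 1)) (v.turn φ) ((ref c a α j).turn (π - 2 * α)) (ψ + φ)
      (Ψ + (π - 2 * α)) :=
  hv.turn h.one_le h.D_pos hφ (by linarith [h.α_pos])
    (by rw [h.turn_n]; exact h.ref_n_nonneg (by positivity) hj)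

theorem step_x {j : ℕ} {v : ArmFrame} {ψ Ψ φ : ℝ}
    (hv : Dominates c (2 * (c + 1)) v (ref c a α j) ψ Ψ) (hφ : |φ| ≤ π - 2 * α)
    (hj : 2 * ((j : ℝ) + 1) * a ≤ π) :
    (ref c a α (j + 1 : ℕ)).x ≤ (v.step c φ).x ∧
      ((ref c a α j).x < v.x ∨ |ψ + φ| < Ψ + (π - 2 * α) →
        (ref c a α (j + 1 : ℕ)).x < (v.step c φ).x) := by
  have := (h.dominates_turn hv hφ hj).go_x h.one_le h.D_pos
  rw [show ((ref c a α j).turn (π - 2 * α)).go c = (ref c a α j).step c (π - 2 * α) from rfl,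
    h.step_ref] at this
  push_cast
  exact this

theorem step_dominates {j : ℕ} {v : ArmFrame} {ψ Ψ φ : ℝ}
    (hv : Dominates c (2 * (c + 1)) v (ref c a α j) ψ Ψ) (hφ : |φ| ≤ π - 2 * α)
    (hj : 2 * ((j : ℝ) + 2) * a ≤ π) :
    ∃ ψ' Ψ', Dominates c (2 * (c + 1)) (v.step c φ) (ref c a α (j + 1 : ℕ)) ψ' Ψ' := by
  have ha := h.a_pos
  have hj0 : (0 : ℝ) ≤ j := j.cast_nonneg
  have h1 : 2 * ((j : ℝ) + 1) * a < π := by nlinarith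
  have := (h.dominates_turn hv hφ h1.le).go h.one_le h.D_pos
    (by rw [h.turn_n]; exact h.ref_n_pos (by positivity) h1)
  rw [show ((ref c a α j).turn (π - 2 * α)).go c = (ref c a α j).step c (π - 2 * α) from rfl,
    h.step_ref] at this
  push_cast
  exact this (h.ref_x_pos (by positivity) (by nlinarith)).le

/-- Domination is needed before every step but not after the last one. The last step therefore may
reach exactly half the polygon, whereas `step_dominates` asks for one more edge of room. -/
theorem arm_x (l : List ℝ) : ∀ (φ : ℝ) (v : ArmFrame) (j : ℕ) (ψ Ψ : ℝ),
    (∀ θ ∈ φ :: l, |θ| ≤ π - 2 * α) → Dominates c (2 * (c + 1)) v (ref c a α j) ψ Ψ →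
    2 * ((j + (l.length + 1) : ℕ) : ℝ) * a ≤ π →
    (ref c a α (j + (l.length + 1) : ℕ)).x ≤ (arm c (φ :: l) v).x ∧
      ((ref c a α j).x < v.x → (ref c a α (j + (l.length + 1) : ℕ)).x < (arm c (φ :: l) v).x) := by
  induction l with
  | nil =>
    intro φ v j ψ Ψ hl hv hj
    have := h.step_x hv (hl φ (by simp)) (by simpa using hj)
    exact ⟨this.1, fun hx => this.2 (Or.inl hx)⟩
  | cons φ' l ih =>
    intro φ v j ψ Ψ hl hv hj
    have ha := h.a_pos
    have hl0 : (0 : ℝ) ≤ l.length := l.length.cast_nonneg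
    simp only [List.length_cons] at hj ⊢
    push_cast at hj
    have h2 : 2 * ((j : ℝ) + 2) * a ≤ π := by nlinarith
    have h1 : 2 * ((j : ℝ) + 1) * a ≤ π := by nlinarith
    have hx := h.step_x hv (hl φ (by simp)) h1
    obtain ⟨ψ', Ψ', hv'⟩ := h.step_dominates hv (hl φ (by simp)) h2
    have := ih φ' (v.step c φ) (j + 1) ψ' Ψ' (fun θ hθ => hl θ (List.mem_cons_of_mem _ hθ)) hv'
      (by push_cast; nlinarith)
    rw [show j + 1 + (l.length + 1) = j + (l.length + 1 + 1) by ring] at this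
    exact ⟨this.1, fun h => this.2 (hx.2 (Or.inl h))⟩

theorem dominates_zero :
    Dominates c (2 * (c + 1)) (ref c a α 0) (ref c a α (0 : ℕ)) 0 0 := by
  have hrad : rad c (2 * (c + 1)) 1 = c + 1 := by
    rw [rad, show (c ^ 2 - 1) * 1 ^ 2 + 2 * (c + 1) = (c + 1) ^ 2 by ring,
      sqrt_sq (by linarith [h.one_le])]
  have : HasDir c (2 * (c + 1)) (ref c a α 0) 0 := by
    rw [h.ref_zero]
    constructor <;> simp [hrad]
  rw [Nat.cast_zero]
  exact ⟨by rw [h.ref_zero]; simp, le_rfl, by simp, pi_pos.le, this, this⟩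

theorem arm_x_zero (l : List ℝ) (hl : ∀ θ ∈ l, |θ| ≤ π - 2 * α)
    (hj : 2 * (l.length : ℝ) * a ≤ π) :
    (ref c a α l.length).x ≤ (arm c l (ref c a α 0)).x := by
  cases l with
  | nil => simp [arm]
  | cons φ l =>
    have := (h.arm_x l φ _ 0 0 0 hl h.dominates_zero (by simpa using hj)).1
    simpa using this

/-- A first turn that is not extreme gains at once. If it is extreme and the second turn differs
from it, the direction already leans to the side of the first turn, and the second turn cannot
attain the largest total deviation. A gain is never lost afterwards. -/
theorem arm_x_zero_lt (l : List ℝ) (φ₁ φ₂ : ℝ) (hl : ∀ θ ∈ φ₁ :: φ₂ :: l, |θ| ≤ π - 2 * α)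
    (hj : 2 * ((l.length : ℝ) + 2) * a ≤ π) (hne : ¬ (φ₁ = φ₂ ∧ |φ₁| = π - 2 * α)) :
    (ref c a α (l.length + 2 : ℕ)).x < (arm c (φ₁ :: φ₂ :: l) (ref c a α 0)).x := by
  have ha := h.a_pos
  have hl0 : (0 : ℝ) ≤ l.length := l.length.cast_nonneg
  have h1 : |φ₁| ≤ π - 2 * α := hl φ₁ (by simp)
  have h2 : |φ₂| ≤ π - 2 * α := hl φ₂ (by simp)
  have h4 : 2 * (((0 : ℕ) : ℝ) + 2) * a ≤ π := by push_cast; nlinarith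
  obtain ⟨ψ, Ψ, hv⟩ := h.step_dominates h.dominates_zero h1 h4
  have hx := h.step_x h.dominates_zero h1 (by push_cast; nlinarith)
  by_cases hext : |φ₁| = π - 2 * α
  · have hne' : φ₁ ≠ φ₂ := fun e => hne ⟨e, hext⟩
    have hstrict : |ψ + φ₂| < Ψ + (π - 2 * α) := by
      obtain ⟨-, -, hψ, hΨ, hdir, -⟩ := hv
      have hn : (ArmFrame.step c φ₁ (ref c a α 0)).n = (c + 1) * sin φ₁ := by
        simp [ArmFrame.step, ArmFrame.go, ArmFrame.turn, h.ref_zero]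
      rw [hdir.2] at hn
      have hrad := rad_pos h.one_le h.D_pos (ArmFrame.step c φ₁ (ref c a α 0)).x
      have hc : 0 < c + 1 := by linarith [h.one_le]
      have hα := h.α_pos
      have hα' := h.α_lt
      have hψ' := abs_le.1 hψ
      have h2' := abs_le.1 h2
      rcases le_total 0 φ₁ with hs | hs
      · rw [abs_of_nonneg hs] at hext
        have : 0 < sin φ₁ := sin_pos_of_pos_of_lt_pi (by linarith) (by linarith)
        have hpos : 0 < ψ := by
          by_contra! hneg
          have := sin_nonpos_of_nonpos_of_neg_pi_le hneg (by linarith)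
          nlinarith
        have : φ₂ < π - 2 * α := lt_of_le_of_ne h2'.2 fun e => hne' (by rw [hext, e])
        exact abs_lt.2 ⟨by linarith, by linarith⟩
      · rw [abs_of_nonpos hs] at hext
        have : sin φ₁ < 0 := sin_neg_of_neg_of_neg_pi_lt (by linarith) (by linarith)
        have hneg : ψ < 0 := by
          by_contra! hpos
          have := sin_nonneg_of_nonneg_of_le_pi hpos (by linarith)
          nlinarith
        have : -(π - 2 * α) < φ₂ := lt_of_le_of_ne h2'.1 fun e => hne' (by rw [← e, ← hext]; ring)
        exact abs_lt.2 ⟨by linarith, by linarith⟩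
    have hx2 := (h.step_x hv h2 (by push_cast; nlinarith)).2 (Or.inr hstrict)
    cases l with
    | nil => simpa [arm] using hx2
    | cons φ₃ l =>
      simp only [List.length_cons, Nat.cast_add, Nat.cast_one] at hj
      have hl0 : (0 : ℝ) ≤ l.length := l.length.cast_nonneg
      obtain ⟨ψ', Ψ', hv'⟩ := h.step_dominates hv h2 (by push_cast; nlinarith)
      have := (h.arm_x l φ₃ _ _ ψ' Ψ' (fun θ hθ => hl θ (by simp_all)) hv'
        (by push_cast; nlinarith)).2 hx2
      rw [show 0 + 1 + 1 + (l.length + 1) = (φ₃ :: l).length + 2 by simp; ring] at this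
      exact this
  · have hx1 := hx.2 (Or.inr (by simpa using lt_of_le_of_ne h1 hext))
    have := (h.arm_x l φ₂ _ _ ψ Ψ (fun θ hθ => hl θ (by simp_all)) hv
        (by push_cast; nlinarith)).2 hx1
    rw [show 0 + 1 + (l.length + 1) = l.length + 2 by ring] at this
    exact this

end IsRegular

/-- Reflection in the line of points where the functional vanishes. -/
def refl (v : ArmFrame) : ArmFrame := ⟨-v.x, v.y, v.n⟩

theorem arm_append (c : ℝ) (l l' : List ℝ) (v : ArmFrame) :
    arm c (l ++ l') v = arm c l' (arm c l v) := List.foldl_append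

theorem go_injective (c : ℝ) : Function.Injective (go c) := by
  intro v w h
  have h1 : c * v.x + v.y = c * w.x + w.y := congrArg ArmFrame.x h
  have h2 : (c ^ 2 - 1) * v.x + c * v.y = (c ^ 2 - 1) * w.x + c * w.y := congrArg ArmFrame.y h
  have h3 : (go c v).n = (go c w).n := congrArg ArmFrame.n h
  have hx : v.x = w.x := by linear_combination c * h1 - h2
  exact ArmFrame.ext hx (by rw [hx] at h1; linarith) h3

/-- An arm traversed backwards is the reflection of an arm. -/
theorem arm_reverse (c : ℝ) (l : List ℝ) (v : ArmFrame) :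
    arm c (l.reverse.map fun φ => -φ) ((arm c l v).refl.go c) = v.refl.go c := by
  induction l generalizing v with
  | nil => rfl
  | cons φ l ih =>
    rw [List.reverse_cons, List.map_append, arm_append]
    have : arm c (φ :: l) v = arm c l (v.step c φ) := rfl
    rw [this, ih]
    simp only [List.map_cons, List.map_nil, arm, List.foldl_cons, List.foldl_nil]
    have hs := sin_sq_add_cos_sq φ
    ext
    · simp only [step, go, turn, refl, cos_neg, sin_neg]
      linear_combination v.y * hs
    · simp only [step, go, turn, refl, cos_neg, sin_neg]
      linear_combination c * v.y * hs
    · simp only [step, go, turn, refl, cos_neg, sin_neg]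
      linear_combination v.n * hs

/-- A closed arm through the midpoint of an edge splits into two arms whose end points lie at
opposite distances from the perpendicular bisector of this edge. -/
theorem arm_add_arm (c : ℝ) (l l' : List ℝ) (φ : ℝ)
    (h : arm c (l ++ φ :: l') ⟨1, c + 1, 0⟩ = ⟨1, c + 1, 0⟩) :
    (arm c l ⟨1, c + 1, 0⟩).x + (arm c (l'.reverse.map fun φ => -φ) ⟨1, c + 1, 0⟩).x = 0 := by
  have hv : ((⟨1, c + 1, 0⟩ : ArmFrame).refl).go c = ⟨1, c + 1, 0⟩ := by
    ext <;> simp only [refl, go] <;> ring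
  rw [arm_append] at h
  have hr := arm_reverse c (φ :: l') (arm c l ⟨1, c + 1, 0⟩)
  rw [h, hv, List.reverse_cons, List.map_append, arm_append] at hr
  have := congrArg ArmFrame.x (go_injective c hr)
  simp only [turn, refl] at this
  rw [this]
  ring

end ArmFrame

end

/-! ### Closed arms and the rotation group of the tessellation -/

section

open Real

namespace ArmFrame

/-- Cut the closed arm at the turn opposite its initial edge. The two halves end at opposite
distances from the bisector of that edge, yet each is at least the distance for the regular polygon.
These reference distances have positive sum if there are fewer than `g` edges and sum zero for `g`
edges, where equality excludes the strict case. -/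
theorem IsRegular.length_eq_of_closed {c a α : ℝ} (h : IsRegular c a α) {g : ℕ} (hg : 5 ≤ g)
    (hga : g * a = π) {l : List ℝ} (hne : l ≠ []) (hlen : l.length ≤ g)
    (hl : ∀ θ ∈ l, |θ| ≤ π - 2 * α) (hclosed : arm c l ⟨1, c + 1, 0⟩ = ⟨1, c + 1, 0⟩) :
    l.length = g ∧ ∃ φ l', l = φ :: φ :: l' ∧ |φ| = π - 2 * α := by
  have ha := h.a_pos
  have hB := h.sin_a
  have hn0 : 0 < l.length := List.length_pos_iff.2 hne
  obtain ⟨k, hk⟩ : ∃ k, k = (l.length - 1) / 2 := ⟨_, rfl⟩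
  obtain ⟨m, hm⟩ : ∃ m, m = l.length - 1 - k := ⟨_, rfl⟩
  have hkl : k < l.length := by lia
  have hdec : l.take k ++ l[k] :: l.drop (k + 1) = l := by
    rw [List.getElem_cons_drop, List.take_append_drop]
  have hsum := arm_add_arm c (l.take k) (l.drop (k + 1)) l[k] (by rw [hdec]; exact hclosed)
  rw [← h.ref_zero] at hsum
  have hle : ∀ i : ℕ, 2 * i ≤ g → 2 * (i : ℝ) * a ≤ π := fun i hi => by
    rw [← hga]
    exact mul_le_mul_of_nonneg_right (by exact_mod_cast hi) ha.le
  have hA := h.arm_x_zero (l.take k) (fun θ hθ => hl θ (List.mem_of_mem_take hθ))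
    (hle _ (by rw [List.length_take]; lia))
  have hA' := h.arm_x_zero ((l.drop (k + 1)).reverse.map fun φ => -φ)
    (fun θ hθ => by
      obtain ⟨φ, hφ, rfl⟩ := List.mem_map.1 hθ
      rw [abs_neg]
      exact hl φ (List.mem_of_mem_drop (List.mem_reverse.1 hφ)))
    (hle _ (by simp; lia))
  rw [List.length_take, min_eq_left hkl.le] at hA
  rw [List.length_map, List.length_reverse, List.length_drop, show l.length - (k + 1) = m by lia]
    at hA'
  have hX : (ref c a α k).x + (ref c a α m).x =
      2 * sin (l.length * a) * cos ((k - m : ℝ) * a) / sin a := by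
    have hlm : (l.length : ℝ) = k + m + 1 := by exact_mod_cast (by lia : l.length = k + m + 1)
    have e1 : (2 * (k : ℝ) + 1) * a = l.length * a + (k - m) * a := by rw [hlm]; ring
    have e2 : (2 * (m : ℝ) + 1) * a = l.length * a - (k - m) * a := by rw [hlm]; ring
    simp only [ref]
    rw [e1, e2, sin_add, sin_sub]
    ring
  have hlt : ¬ l.length < g := by
    intro hlt
    have h1 : 0 < sin (l.length * a) := by
      refine sin_pos_of_pos_of_lt_pi (mul_pos (by exact_mod_cast hn0) ha) ?_
      rw [← hga]
      exact mul_lt_mul_of_pos_right (by exact_mod_cast hlt) ha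
    have h2 : 0 < cos ((k - m : ℝ) * a) := by
      rcases (by lia : m = k ∨ m = k + 1) with e | e
      · simp [e]
      · rw [e]
        have : ((k : ℝ) - (k + 1 : ℕ)) * a = -a := by push_cast; ring
        rw [this, cos_neg]
        exact h.cos_a
    have : 0 < 2 * sin (l.length * a) * cos ((k - m : ℝ) * a) / sin a := by positivity
    linarith
  have hlg : l.length = g := by lia
  refine ⟨hlg, ?_⟩
  rw [hlg, hga, sin_pi, mul_zero, zero_mul, zero_div] at hX
  obtain ⟨φ₁, φ₂, l', rfl⟩ : ∃ φ₁ φ₂ l', l = φ₁ :: φ₂ :: l' := by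
    match l, hlg with
    | [], e => simp at e; lia
    | [_], e => simp at e; lia
    | φ₁ :: φ₂ :: l', _ => exact ⟨φ₁, φ₂, l', rfl⟩
  -- Here `g ≥ 5` matters: the first half must contain two turns.
  obtain ⟨k', rfl⟩ : ∃ k', k = k' + 2 := ⟨k - 2, by lia⟩
  by_cases hext : φ₁ = φ₂ ∧ |φ₁| = π - 2 * α
  · exact ⟨φ₁, l', by rw [← hext.1], hext.2⟩
  · exfalso
    simp only [List.take_succ_cons] at hA hsum
    have hlen' : (l'.take k').length = k' := by
      rw [List.length_take]
      exact min_eq_left (by simp at hkl; lia)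
    have := h.arm_x_zero_lt (l'.take k') φ₁ φ₂
      (fun θ hθ => hl θ (by
        simp only [List.mem_cons] at hθ ⊢
        exact hθ.imp id (Or.imp id List.mem_of_mem_take)))
      (by rw [hlen']; exact_mod_cast hle (k' + 2) (by lia)) hext
    rw [hlen'] at this
    linarith

open Matrix

/-- The coordinates of a frame, as a row vector. -/
def vec (v : ArmFrame) : Fin 3 → ℝ := ![v.x, v.y, v.n]

theorem vec_injective : Function.Injective vec := fun _ _ h =>
  ArmFrame.ext (congrFun h 0) (congrFun h 1) (congrFun h 2)

/-- The matrix of a turn. -/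
noncomputable def rotMatrix (θ : ℝ) : Matrix (Fin 3) (Fin 3) ℝ :=
  !![1, 0, 0; 0, cos θ, sin θ; 0, -sin θ, cos θ]

/-- The matrix of the half turn about the midpoint of an edge. -/
def flipMatrix (c : ℝ) : Matrix (Fin 3) (Fin 3) ℝ :=
  !![c, c ^ 2 - 1, 0; -1, -c, 0; 0, 0, -1]

theorem rotMatrix_mul (θ φ : ℝ) : rotMatrix θ * rotMatrix φ = rotMatrix (θ + φ) := by
  ext i j
  fin_cases i <;> fin_cases j <;>
    simp [rotMatrix, Matrix.mul_apply, Fin.sum_univ_three, cos_add, sin_add] <;> ring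

theorem rotMatrix_zero : rotMatrix 0 = 1 := by
  ext i j
  fin_cases i <;> fin_cases j <;> simp [rotMatrix]

theorem flipMatrix_mul_self (c : ℝ) : flipMatrix c * flipMatrix c = 1 := by
  ext i j
  fin_cases i <;> fin_cases j <;>
    simp [flipMatrix, Matrix.mul_apply, Fin.sum_univ_three] <;> ring

theorem rotMatrix_pow (θ : ℝ) (j : ℕ) : rotMatrix θ ^ j = rotMatrix (j * θ) := by
  induction j with
  | zero => simp [rotMatrix_zero]
  | succ j ih => rw [pow_succ, ih, rotMatrix_mul]; congr 1; push_cast; ring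

/-- The half turn carries the frame across the edge facing backwards, which accounts for the `-π` in
the rotation. -/
theorem vec_vecMul (c θ : ℝ) (v : ArmFrame) :
    v.vec ᵥ* (rotMatrix (θ - π) * flipMatrix c) = (v.step c θ).vec := by
  rw [← vecMul_vecMul]
  ext i
  fin_cases i <;>
    simp [vec, rotMatrix, flipMatrix, step, turn, go, vecMul, dotProduct, Fin.sum_univ_three,
      sin_sub_pi, cos_sub_pi] <;> ring

/-- The rotation about a vertex. -/
noncomputable def rotUnit (α : ℝ) : (Matrix (Fin 3) (Fin 3) ℝ)ˣ :=
  ⟨rotMatrix (-(2 * α)), rotMatrix (2 * α), by rw [rotMatrix_mul]; simp [rotMatrix_zero],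
    by rw [rotMatrix_mul]; simp [rotMatrix_zero]⟩

/-- The half turn about the midpoint of an edge. -/
def flipUnit (c : ℝ) : (Matrix (Fin 3) (Fin 3) ℝ)ˣ :=
  ⟨flipMatrix c, flipMatrix c, flipMatrix_mul_self c, flipMatrix_mul_self c⟩

theorem vec_vecMul_pow_mul (c α : ℝ) (j : ℕ) (v : ArmFrame) :
    v.vec ᵥ* ((rotUnit α ^ j * flipUnit c : (Matrix (Fin 3) (Fin 3) ℝ)ˣ) : Matrix _ _ ℝ) =
      (v.step c (π - 2 * j * α)).vec := by
  rw [← vec_vecMul]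
  simp only [Units.val_mul, Units.val_pow_eq_pow_val, rotUnit, flipUnit, rotMatrix_pow]
  congr 3
  ring

theorem vec_vecMul_prod (c α : ℝ) (l : List ℕ) (v : ArmFrame) :
    v.vec ᵥ* (((l.map fun j => rotUnit α ^ j * flipUnit c).prod :
      (Matrix (Fin 3) (Fin 3) ℝ)ˣ) : Matrix _ _ ℝ) =
      (arm c (l.map fun j : ℕ => π - 2 * j * α) v).vec := by
  induction l generalizing v with
  | nil => simp [arm]
  | cons j l ih =>
    simp only [List.map_cons, List.prod_cons]
    rw [Units.val_mul, ← vecMul_vecMul, vec_vecMul_pow_mul, ih]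
    rfl

theorem ref_add_nat {c a α : ℝ} {g : ℕ} (hga : g * a = π) (t : ℝ) :
    ref c a α (t + g) = ref c a α t := by
  have e1 : (2 * (t + g) + 1) * a = (2 * t + 1) * a + 2 * π := by rw [← hga]; ring
  have e2 : (2 * (t + g) - 1) * a = (2 * t - 1) * a + 2 * π := by rw [← hga]; ring
  have e3 : 2 * (t + g) * a = 2 * t * a + 2 * π := by rw [← hga]; ring
  simp only [ref, e1, e2, e3, sin_add_two_pi]

/-- The frames at the centre of the face. -/
noncomputable def center (c α : ℝ) : ArmFrame := ⟨1, c - 1, (c - 1) * sin α / cos α⟩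

theorem IsRegular.step_center {c a α : ℝ} (h : IsRegular c a α) :
    (center c α).step c (π - 2 * α) = center c α := by
  have hq := h.cos_α
  have hq2 := sin_sq_add_cos_sq α
  have hcos : cos (π - 2 * α) = 1 - 2 * cos α ^ 2 := by
    rw [cos_pi_sub, cos_two_mul]; ring
  have hsin : sin (π - 2 * α) = 2 * sin α * cos α := by rw [sin_pi_sub, sin_two_mul]
  have key : (c - 1) * cos (π - 2 * α) - (c - 1) * sin α / cos α * sin (π - 2 * α) = 1 - c := by
    rw [hcos, hsin]
    field_simp
    linear_combination -2 * (c - 1) * hq2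
  ext
  · simp only [step, turn, go, center]; rw [key]; ring
  · simp only [step, turn, go, center]; rw [key]; ring
  · simp only [step, turn, go, center]
    rw [hcos, hsin]
    field_simp
    ring

/-- The product is the rotation about a face centre: it fixes `center` and sends `ref t` to `ref (t
+ 1)`, which has period `g` in `t`. Its `g`-th power thus fixes three independent row vectors. -/
theorem IsRegular.rot_mul_flip_pow {c a α : ℝ} (h : IsRegular c a α) {g : ℕ}
    (hga : g * a = π) : (rotUnit α * flipUnit c) ^ g = 1 := by
  have hstep : ∀ v : ArmFrame, v.vec ᵥ* (rotUnit α * flipUnit c).val = (v.step c (π - 2 * α)).vec := fun v => by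
    simpa using vec_vecMul_pow_mul c α 1 v
  set W : Matrix (Fin 3) (Fin 3) ℝ := (rotUnit α * flipUnit c).val with hW
  have hcen : ∀ k : ℕ, (center c α).vec ᵥ* W ^ k = (center c α).vec := by
    intro k
    induction k with
    | zero => simp
    | succ k ih => rw [pow_succ, ← vecMul_vecMul, ih, hstep, h.step_center]
  have href : ∀ (t : ℝ) (k : ℕ), (ref c a α t).vec ᵥ* W ^ k = (ref c a α (t + k)).vec := by
    intro t k
    induction k with
    | zero => simp
    | succ k ih =>
      rw [pow_succ, ← vecMul_vecMul, ih, hstep, h.step_ref]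
      push_cast
      rw [add_assoc]
  let M : Matrix (Fin 3) (Fin 3) ℝ :=
    Matrix.of ![(center c α).vec, (ref c a α 0).vec, (ref c a α (-1 / 2)).vec]
  have hM : M * W ^ g = M := by
    funext i
    rw [mul_apply_eq_vecMul]
    fin_cases i
    · exact hcen g
    · exact (href 0 g).trans (by rw [ref_add_nat hga]; rfl)
    · exact (href (-1 / 2) g).trans (by rw [ref_add_nat hga]; rfl)
  have hdet : M.det ≠ 0 := by
    have hA := h.cos_a
    have hB := h.sin_a
    have hp := h.sin_α
    have hq := h.cos_α
    have hc := h.one_le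
    have e1 : (2 * (-1 / 2 : ℝ) + 1) * a = 0 := by ring
    have e2 : (2 * (-1 / 2 : ℝ) - 1) * a = -(2 * a) := by ring
    have e3 : 2 * (-1 / 2 : ℝ) * a = -a := by ring
    have hw : ref c a α (-1 / 2) = ⟨0, 2 * cos a, -((c + 1) * sin α * cos α / cos a)⟩ := by
      simp only [ref, e1, e2, e3, sin_zero, sin_neg, sin_two_mul]
      ext <;> dsimp only <;> field_simp <;> ring
    have : M.det = -(2 * sin α / (cos α * cos a) * ((c + 1) * sin a ^ 2)) := by
      simp only [M, hw, h.ref_zero, det_fin_three, center, vec, of_apply, cons_val', cons_val_zero,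
        cons_val_one, cons_val]
      have hq2 := sin_sq_add_cos_sq α
      have hA2 := sin_sq_add_cos_sq a
      have hrel := h.rel
      field_simp
      linear_combination -2 * sin α * (c + 1) * hq2 + 2 * sin α * hrel + 2 * sin α * (c + 1) * hA2
    rw [this, neg_ne_zero]
    have : 0 < c + 1 := by linarith
    positivity
  refine Units.ext ?_
  rw [Units.val_pow_eq_pow_val, ← hW, Units.val_one]
  have hu : IsUnit M.det := hdet.isUnit
  calc W ^ g = M⁻¹ * (M * W ^ g) := by rw [← Matrix.mul_assoc, nonsing_inv_mul _ hu, one_mul]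
    _ = 1 := by rw [hM, nonsing_inv_mul _ hu]

theorem IsRegular.isMapPair {c : ℝ} {g lam : ℕ} (hlam : 3 ≤ lam) (hg : 5 ≤ g)
    (h : IsRegular c (π / g) (π / lam)) :
    IsMapPair (rotUnit (π / lam)) (flipUnit c) g lam := by
  have hlam0 : (0 : ℝ) < lam := by exact_mod_cast (by lia : 0 < lam)
  have hg0 : (0 : ℝ) < g := by exact_mod_cast (by lia : 0 < g)
  have hga : (g : ℝ) * (π / g) = π := by field_simp
  refine ⟨hlam, by lia, ?_, ?_, h.rot_mul_flip_pow hga, ?_⟩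
  · refine Units.ext ?_
    rw [Units.val_pow_eq_pow_val, rotUnit, rotMatrix_pow, Units.val_one,
      show (lam : ℝ) * -(2 * (π / lam)) = -(2 * π) by field_simp]
    ext i j
    fin_cases i <;> fin_cases j <;> simp [rotMatrix]
  · exact Units.ext (flipMatrix_mul_self c)
  · intro l hne hlen hl hprod
    have hα : 0 < π / lam := h.α_pos
    have hlamα : (lam : ℝ) * (π / lam) = π := by field_simp
    have hext : ∀ j : ℕ, 0 < j → j < lam → |π - 2 * j * (π / lam)| ≤ π - 2 * (π / lam) ∧
        (|π - 2 * j * (π / lam)| = π - 2 * (π / lam) → j = 1 ∨ j + 1 = lam) := by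
      intro j h0 hj
      have h0' : (1 : ℝ) ≤ j := by exact_mod_cast h0
      have hj' : (j : ℝ) + 1 ≤ lam := by exact_mod_cast hj
      refine ⟨abs_le.2 ⟨by nlinarith, by nlinarith⟩, fun e => ?_⟩
      rcases abs_choice (π - 2 * j * (π / lam)) with e' | e'
      · left
        rw [e'] at e
        have : (j : ℝ) * (π / lam) = 1 * (π / lam) := by linarith
        exact_mod_cast mul_right_cancel₀ hα.ne' this
      · right
        rw [e'] at e
        have : ((j : ℝ) + 1) * (π / lam) = lam * (π / lam) := by linarith
        exact_mod_cast mul_right_cancel₀ hα.ne' this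
    -- Every cyclic rotation of a trivial word is trivial, so what is known of the first two turns
    -- holds for every consecutive pair.
    have key : ∀ i, l.length = g ∧ ∃ j l', l.rotate i = j :: j :: l' ∧ (j = 1 ∨ j + 1 = lam) := by
      intro i
      have hli : ∀ j ∈ l.rotate i, 0 < j ∧ j < lam := fun j hj => hl j (List.mem_rotate.1 hj)
      have hp : ((l.rotate i).map fun j => rotUnit (π / lam) ^ j * flipUnit c).prod = 1 := by
        rw [List.map_rotate]
        exact List.prod_rotate_eq_one_of_prod_eq_one hprod i
      have hv := vec_vecMul_prod c (π / lam) (l.rotate i) ⟨1, c + 1, 0⟩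
      rw [hp, Units.val_one, vecMul_one] at hv
      have := h.length_eq_of_closed hg hga (l := (l.rotate i).map fun j : ℕ => π - 2 * j * (π / lam))
        (by simpa using hne) (by simpa using hlen)
        (fun θ hθ => by
          obtain ⟨j, hj, rfl⟩ := List.mem_map.1 hθ
          exact (hext j (hli j hj).1 (hli j hj).2).1)
        (vec_injective hv.symm)
      obtain ⟨hlg, φ, l', e, hφ⟩ := this
      refine ⟨by simpa using hlg, ?_⟩
      match hm : l.rotate i, e with
      | j :: j' :: l'', e =>
        rw [List.map_cons, List.map_cons, List.cons.injEq, List.cons.injEq] at e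
        rw [hm] at hli
        have hjj : j = j' := by
          have := e.1.trans e.2.1.symm
          have : (j : ℝ) * (π / lam) = j' * (π / lam) := by linarith
          exact_mod_cast mul_right_cancel₀ hα.ne' this
        subst hjj
        rw [← e.1] at hφ
        exact ⟨j, l'', rfl, (hext j (hli j (by simp)).1 (hli j (by simp)).2).2 hφ⟩
    have hlg := (key 0).1
    refine ⟨hlg, ?_⟩
    have hsucc : ∀ i (hi : i + 1 < l.length), l[i + 1] = l[i] ∧ (l[i] = 1 ∨ l[i] + 1 = lam) := by
      intro i hi
      obtain ⟨-, j, l', e, hj⟩ := key i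
      have h0 : (l.rotate i)[0]'(by simp; lia) = l[i] := by
        rw [List.getElem_rotate]; congr 1; rw [zero_add]; exact Nat.mod_eq_of_lt (by lia)
      have h1 : (l.rotate i)[1]'(by simp; lia) = l[i + 1] := by
        rw [List.getElem_rotate]; congr 1; rw [add_comm]; exact Nat.mod_eq_of_lt hi
      simp only [e, List.getElem_cons_zero, List.getElem_cons_succ] at h0 h1
      rw [← h0, ← h1]
      exact ⟨rfl, hj⟩
    have hall : ∀ i (hi : i < l.length), l[i] = l[0] := by
      intro i
      induction i with
      | zero => intro _; rfl
      | succ i ih => intro hi; rw [(hsucc i hi).1, ih (by lia)]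
    have h0 := (hsucc 0 (by lia)).2
    refine h0.imp (fun h0 j hj => ?_) (fun h0 j hj => ?_) <;>
    · obtain ⟨i, hi, rfl⟩ := List.mem_iff_getElem.1 hj
      rw [hall i hi, h0]

end ArmFrame

end

/-! ### Reduction to finite fields -/

section

theorem isJacobsonRing_int : IsJacobsonRing ℤ := by
  refine isJacobsonRing_iff_prime_eq.2 fun P hP => ?_
  by_cases h : P = ⊥
  · subst h
    rw [eq_bot_iff]
    intro x hx
    rw [Ideal.mem_jacobson_bot] at hx
    by_contra hx0
    have hx0 : x ≠ 0 := hx0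
    have h1 := Int.isUnit_iff.1 (hx (3 * x))
    have : 0 < x * x := mul_self_pos.2 hx0
    rcases h1 with h1 | h1 <;> nlinarith
  · exact Ideal.jacobson_eq_self_of_isMaximal (H := hP.isMaximal h)

/-- By the Nullstellensatz over the Jacobson ring `ℤ`, `K` is a finite `ℤ`-module. It cannot contain
`ℤ`, which would then be a field, so it is torsion and hence finite. -/
theorem finite_of_field_of_finiteType (K : Type*) [Field K] [inst : Algebra ℤ K]
    [Algebra.FiniteType ℤ K] : Finite K := by
  obtain rfl : inst = Ring.toIntAlgebra K := Subsingleton.elim _ _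
  have := isJacobsonRing_int
  have hfin : Module.Finite ℤ K := finite_of_finite_type_of_isJacobsonRing ℤ K
  obtain ⟨n, hn, hn0⟩ : ∃ n : ℤ, algebraMap ℤ K n = 0 ∧ n ≠ 0 := by
    by_contra! h
    exact Int.not_isField (isField_of_isIntegral_of_isField
      ((injective_iff_map_eq_zero (algebraMap ℤ K)).2 h) (Field.toIsField K))
  refine Module.finite_of_fg_torsion K fun y => ⟨⟨n, mem_nonZeroDivisors_of_ne_zero hn0⟩, ?_⟩
  change n • y = 0
  rw [Algebra.smul_def, hn, zero_mul]

theorem exists_ringHom_finite_field {A : Type} [CommRing A] [Nontrivial A] [Algebra ℤ A]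
    [Algebra.FiniteType ℤ A] : ∃ (K : Type) (_ : Field K) (_ : Finite K), Nonempty (A →+* K) := by
  obtain ⟨M, hM⟩ := Ideal.exists_maximal A
  let _ : Field (A ⧸ M) := Ideal.Quotient.field M
  have : Algebra.FiniteType ℤ (A ⧸ M) :=
    .of_surjective (Ideal.Quotient.mkₐ ℤ M) (Ideal.Quotient.mkₐ_surjective _ _)
  exact ⟨A ⧸ M, inferInstance, finite_of_field_of_finiteType _, ⟨Ideal.Quotient.mk M⟩⟩

/-- A nonzero element of a finitely generated domain over `ℤ` survives in some finite field. -/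
theorem exists_ringHom_finite_field_ne_zero {B : Type} [CommRing B] [IsDomain B]
    [Algebra.FiniteType ℤ B] {x : B} (hx : x ≠ 0) :
    ∃ (K : Type) (_ : Field K) (_ : Finite K) (φ : B →+* K), φ x ≠ 0 := by
  let A := Localization.Away x
  have : Algebra.FiniteType B A := IsLocalization.finiteType_of_monoid_fg (Submonoid.powers x) _
  have : Algebra.FiniteType ℤ A := Algebra.FiniteType.trans (S := B) inferInstance inferInstance
  have : Nontrivial A := (IsLocalization.injective A
    (powers_le_nonZeroDivisors_of_noZeroDivisors hx)).nontrivial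
  obtain ⟨K, _, _, ⟨φ⟩⟩ := exists_ringHom_finite_field (A := A)
  exact ⟨K, inferInstance, inferInstance, φ.comp (algebraMap B A),
    ((IsLocalization.Away.algebraMap_isUnit (S := A) x).map φ).ne_zero⟩

theorem finite_setOf_bounded_words (g lam : ℕ) :
    {l : List ℕ | l.length ≤ g ∧ ∀ j ∈ l, j < lam}.Finite := by
  refine ((List.finite_length_le (Fin lam) g).image (List.map Fin.val)).subset ?_
  rintro l ⟨hl, hj⟩
  exact ⟨l.pmap Fin.mk hj, by simpa using hl, by simp [List.map_pmap]⟩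

theorem exists_ringHom_finite_field_of_finite {B : Type} [CommRing B] [IsDomain B]
    [Algebra.FiniteType ℤ B] {S : Set B} (hS : S.Finite) (h0 : (0 : B) ∉ S) :
    ∃ (K : Type) (_ : Field K) (_ : Finite K) (φ : B →+* K), ∀ x ∈ S, φ x ≠ 0 := by
  have hx : ∏ x ∈ hS.toFinset, x ≠ 0 := Finset.prod_ne_zero_iff.2 fun x hx h =>
    h0 (h ▸ hS.mem_toFinset.1 hx)
  obtain ⟨K, _, _, φ, h⟩ := exists_ringHom_finite_field_ne_zero hx
  refine ⟨K, inferInstance, inferInstance, φ, fun x hxS => ?_⟩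
  rw [map_prod] at h
  exact Finset.prod_ne_zero_iff.1 h x (hS.mem_toFinset.2 hxS)

/-- The matrix entries generate a domain of finite type over `ℤ`. For each of the finitely many
nontrivial short words choose a nonzero entry of the word minus `1`; a map to a finite field that
keeps these entries nonzero creates no new short relation. -/
theorem IsMapPair.exists_finite {n : Type} [Fintype n] [DecidableEq n] [Nonempty n]
    {F : Type} [Field F]
    {r s : (Matrix n n F)ˣ} {g lam : ℕ} (h : IsMapPair r s g lam) :
    ∃ (P : Type) (_ : Group P) (_ : Finite P) (r' s' : P), IsMapPair r' s' g lam := by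
  classical
  have h3 := h.three_le_lam
  let E : Set F := Set.range (fun i : n × n => r.1 i.1 i.2) ∪ Set.range fun i : n × n => s.1 i.1 i.2
  let B := Algebra.adjoin ℤ E
  have : Algebra.FiniteType ℤ B := Algebra.FiniteType.adjoin_of_finite
    ((Set.finite_range _).union (Set.finite_range _))
  let R : Matrix n n B := fun i j => ⟨r.1 i j, Algebra.subset_adjoin (Or.inl ⟨(i, j), rfl⟩)⟩
  let S : Matrix n n B := fun i j => ⟨s.1 i j, Algebra.subset_adjoin (Or.inr ⟨(i, j), rfl⟩)⟩
  let f : Matrix n n B →+* Matrix n n F := (algebraMap B F).mapMatrix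
  have hf : Function.Injective f := Matrix.map_injective Subtype.val_injective
  have hfR : f R = r.1 := rfl
  have hfS : f S = s.1 := rfl
  let w : List ℕ → Matrix n n B := fun l => (l.map fun j => R ^ j * S).prod
  have hfw (l : List ℕ) : f (w l) = ((l.map fun j => r ^ j * s).prod : (Matrix n n F)ˣ) := by
    induction l with
    | nil => simp [w]
    | cons j l ih => simp_all [w]
  have hR : R ^ lam = 1 := hf (by rw [map_pow, hfR, ← Units.val_pow_eq_pow_val, h.r_pow]; simp)
  have hS : S * S = 1 := hf (by rw [map_mul, hfS, ← Units.val_mul, h.s_mul]; simp)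
  have hRS : (R * S) ^ g = 1 :=
    hf (by rw [map_pow, map_mul, hfS, hfR, ← Units.val_mul, ← Units.val_pow_eq_pow_val, h.rs_pow]; simp)
  have hne (l : List ℕ) : ∃ i : n × n, w l ≠ 1 → (w l - 1) i.1 i.2 ≠ 0 := by
    by_contra! hc
    obtain ⟨i, j, hij⟩ : ∃ i j, (w l - 1) i j ≠ 0 := by
      by_contra! h0
      exact (hc (Classical.arbitrary _)).1 (sub_eq_zero.1 (by ext i j; exact congrArg _ (h0 i j)))
    exact hij (hc (i, j)).2
  choose e he using hne
  obtain ⟨K, _, _, φ, hφ⟩ := exists_ringHom_finite_field_of_finite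
    (((finite_setOf_bounded_words g lam).subset
      (t := {l | (l.length ≤ g ∧ ∀ j ∈ l, j < lam) ∧ w l ≠ 1}) fun l hl => hl.1).image
        fun l => (w l - 1) (e l).1 (e l).2)
    (by rintro ⟨l, hl, h0⟩; exact he l hl.2 h0)
  let ψ : Matrix n n B →+* Matrix n n K := φ.mapMatrix
  let r' : (Matrix n n K)ˣ := Units.ofPowEqOne (ψ R) lam (by rw [← map_pow, hR, map_one]) (by lia)
  let s' : (Matrix n n K)ˣ := ⟨ψ S, ψ S, by rw [← map_mul, hS, map_one],
    by rw [← map_mul, hS, map_one]⟩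
  have hψw (l : List ℕ) : ψ (w l) = ((l.map fun j => r' ^ j * s').prod : (Matrix n n K)ˣ) := by
    induction l with
    | nil => simp [w]
    | cons j l ih => simp_all [w, r', s']
  refine ⟨(Matrix n n K)ˣ, inferInstance, inferInstance, r', s', h3, h.three_le_g,
    Units.pow_ofPowEqOne _ _, Units.ext ?_, Units.ext ?_, fun l hl hlg hj hw => ?_⟩
  · change ψ S * ψ S = 1
    rw [← map_mul, hS, map_one]
  · change (ψ R * ψ S) ^ g = 1
    rw [← map_mul, ← map_pow, hRS, map_one]
  · refine h.words l hl hlg hj (Units.ext ?_)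
    rw [← hfw]
    suffices hw1 : w l = 1 by rw [hw1, map_one]; rfl
    by_contra hw1
    refine hφ _ ⟨l, ⟨⟨hlg, fun j hjl => (hj j hjl).2⟩, hw1⟩, rfl⟩ ?_
    have : ψ (w l - 1) = 0 := by rw [map_sub, hψw, hw]; simp
    exact congrFun (congrFun this _) _

open Real in
theorem hasBlock_of_six_le {g lam : ℕ} (hg : 6 ≤ g) (hlam : 3 ≤ lam) : HasBlock g lam lam 0 := by
  have hπ := pi_pos
  have hg' : (6 : ℝ) ≤ g := by exact_mod_cast hg
  have hlam' : (3 : ℝ) ≤ lam := by exact_mod_cast hlam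
  have hα : π / lam ≤ π / 3 := by gcongr
  have ha : π / g ≤ π / 6 := by gcongr
  have hα0 : 0 < π / lam := by positivity
  have ha0 : 0 < π / g := by positivity
  have hs0 : 0 < sin (π / lam) := sin_pos_of_pos_of_lt_pi hα0 (by linarith)
  have hs : sin (π / lam) ≤ sin (π / 3) := sin_le_sin_of_le_of_le_pi_div_two (by linarith)
    (by linarith) hα
  have hc : cos (π / 6) ≤ cos (π / g) := cos_le_cos_of_nonneg_of_le_pi ha0.le (by linarith) ha
  rw [sin_pi_div_three] at hs
  rw [cos_pi_div_six] at hc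
  -- `c` is solved from `rel`; `c ≥ 1` holds because `sin (π / lam) ≤ √3 / 2 ≤ cos (π / g)`, with
  -- equality throughout in the Euclidean case.
  have hreg : ArmFrame.IsRegular (2 * cos (π / g) ^ 2 / sin (π / lam) ^ 2 - 1) (π / g) (π / lam) :=
    { one_le := by
        have : sin (π / lam) ^ 2 ≤ cos (π / g) ^ 2 := by gcongr; linarith
        have : 2 ≤ 2 * cos (π / g) ^ 2 / sin (π / lam) ^ 2 := by
          rw [le_div_iff₀ (by positivity)]; linarith
        linarith
      a_pos := ha0
      a_lt := by linarith
      α_pos := hα0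
      α_lt := by linarith
      rel := by field_simp; ring }
  obtain ⟨P, _, _, r, s, h⟩ := (hreg.isMapPair hlam (by lia)).exists_finite
  exact ⟨P ⧸ Subgroup.zpowers r, inferInstance, inferInstance, _, isBlock_mapGraph h, zero_le⟩

end

/-! ### Elementary blocks and the case of triangles -/

section

open SimpleGraph

section Triangles

open Equiv

theorem isMapPair_three {P : Type*} [Group P] {r s : P} {lam : ℕ} (hlam : 3 ≤ lam)
    (hr : r ^ lam = 1) (hs : s * s = 1) (hrs : (r * s) ^ 3 = 1)
    (h1 : ∀ a < lam, r ^ a * s ≠ 1)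
    (h2 : ∀ a < lam, ∀ b < lam, 0 < a → 0 < b → r ^ a * s * (r ^ b * s) ≠ 1)
    (h3 : ∀ a b c : Fin lam, 0 < a.1 ∧ 0 < b.1 ∧ 0 < c.1 ∧
      r ^ a.1 * s * (r ^ b.1 * s) * (r ^ c.1 * s) = 1 →
      (a.1 = 1 ∧ b.1 = 1 ∧ c.1 = 1) ∨ (a.1 + 1 = lam ∧ b.1 + 1 = lam ∧ c.1 + 1 = lam)) :
    IsMapPair r s 3 lam := by
  refine ⟨hlam, le_rfl, hr, hs, hrs, fun l h0 hl hj hw => ?_⟩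
  match l, h0, hl, hj, hw with
  | [a], _, _, hj, hw => exact absurd (by simpa using hw) (h1 a (hj a (by simp)).2)
  | [a, b], _, _, hj, hw =>
    exact absurd (by simpa using hw)
      (h2 a (hj a (by simp)).2 b (hj b (by simp)).2 (hj a (by simp)).1 (hj b (by simp)).1)
  | [a, b, c], _, _, hj, hw =>
    refine ⟨rfl, ?_⟩
    simpa using h3 ⟨a, (hj a (by simp)).2⟩ ⟨b, (hj b (by simp)).2⟩ ⟨c, (hj c (by simp)).2⟩
      ⟨(hj a (by simp)).1, (hj b (by simp)).1, (hj c (by simp)).1,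
        by simpa [mul_assoc] using hw⟩

theorem isMapPair_tetrahedron :
    IsMapPair (P := Perm (Fin 4)) c[0, 1, 2] (c[0, 1] * c[2, 3]) 3 3 := by
  apply isMapPair_three <;> decide +kernel

theorem isMapPair_octahedron :
    IsMapPair (P := Perm (Fin 4)) c[0, 1, 2, 3] c[0, 1] 3 4 := by
  apply isMapPair_three <;> decide +kernel

theorem isMapPair_icosahedron :
    IsMapPair (P := Perm (Fin 5)) c[0, 1, 2, 3, 4] (c[0, 1] * c[2, 3]) 3 5 := by
  apply isMapPair_three <;> decide +kernel

end Triangles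

theorem IsMapPair.hasBlock {P : Type} [Group P] [Finite P] {r s : P} {g lam : ℕ}
    (h : IsMapPair r s g lam) : HasBlock g lam lam 0 :=
  ⟨P ⧸ Subgroup.zpowers r, inferInstance, inferInstance, _, isBlock_mapGraph h, zero_le⟩

theorem HasBlock.add {g d l m d' l' m' : ℕ} (h : HasBlock g d l m) (h' : HasBlock g d' l' m') :
    HasBlock g (d + d') (l + l') m := by
  have := HasBlock.sum (ι := Bool) (g := g) (d := fun b => cond b d d') (l := fun b => cond b l l')
    (m := fun b => cond b m m') (by rintro (_ | _) <;> assumption) true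
  simpa using this

theorem hasBlock_three {lam : ℕ} (h : 3 ≤ lam) : HasBlock 3 lam lam 0 := by
  induction lam using Nat.strong_induction_on with
  | _ lam ih =>
    rcases Nat.lt_or_ge lam 6 with h6 | h6
    · interval_cases lam
      · exact isMapPair_tetrahedron.hasBlock
      · exact isMapPair_octahedron.hasBlock
      · exact isMapPair_icosahedron.hasBlock
    · have := (ih (lam - 3) (by lia) (by lia)).add isMapPair_tetrahedron.hasBlock
      rwa [Nat.sub_add_cancel h] at this

/-- The cycle on the vertex set `ZMod g`. -/
def zmodCycle (g : ℕ) (hg : 3 ≤ g) : SimpleGraph (ZMod g) where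
  Adj u v := v = u + 1 ∨ v = u + -1
  symm := ⟨by rintro u v (rfl | rfl) <;> simp⟩
  loopless := ⟨by
    have : Fact (1 < g) := ⟨by lia⟩
    rintro u (h | h) <;> simp at h⟩

/-- A change of direction would repeat a vertex two steps apart, so a cycle keeps one direction. -/
theorem zmodCycle_seq {g n : ℕ} (hg : 3 ≤ g) {p : ℕ → ZMod g} (hp : IsCyc (zmodCycle g hg) n p) :
    ∃ e : ZMod g, (e = 1 ∨ e = -1) ∧ ∀ k ≤ n, p k = p 0 + k * e := by
  have h3 := hp.three_le
  obtain ⟨e, he, h1⟩ : ∃ e : ZMod g, (e = 1 ∨ e = -1) ∧ p 1 = p 0 + e := by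
    rcases hp.adj 0 (by lia) with h | h
    · exact ⟨1, .inl rfl, h⟩
    · exact ⟨-1, .inr rfl, h⟩
  have hstep : ∀ k < n, p (k + 1) = p k + e := by
    intro k
    induction k with
    | zero => exact fun _ => h1
    | succ k ih =>
      intro hk
      by_contra hne
      have h2 : p (k + 1 + 1) = p k := by
        have := ih (by lia)
        rcases hp.adj (k + 1) hk with h | h <;> rcases he with rfl | rfl
        · exact absurd h hne
        · rw [h, this]; simp
        · rw [h, this]; simp
        · exact absurd h hne
      rcases Nat.lt_or_ge (k + 1 + 1) n with hlt | hge
      · have := hp.inj _ hlt _ (by lia) h2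
        lia
      · obtain rfl : k + 1 + 1 = n := by lia
        have := hp.inj 0 (by lia) k (by lia) (hp.closed.symm.trans h2)
        lia
  refine ⟨e, he, fun k => ?_⟩
  induction k with
  | zero => simp
  | succ k ih =>
    intro hk
    rw [hstep k hk, ih (by lia)]
    push_cast
    ring

theorem isBlock_zmodCycle {g : ℕ} (hg : 3 ≤ g) : IsBlock (zmodCycle g hg) g 2 1 := by
  have : NeZero g := ⟨by lia⟩
  have h2 : (2 : ZMod g) ≠ 0 := fun h => by
    have := (ZMod.natCast_eq_zero_iff 2 g).1 (by exact_mod_cast h)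
    have := Nat.le_of_dvd (by lia) this
    lia
  refine ⟨fun u => ?_, fun n p hp => ?_, fun u => ?_⟩
  · have : (zmodCycle g hg).neighborSet u = {u + 1, u + -1} := rfl
    rw [this, Set.ncard_pair]
    intro h
    refine h2 ?_
    have := add_left_cancel h
    linear_combination this
  · obtain ⟨e, he, h⟩ := zmodCycle_seq hg hp
    have h3 := hp.three_le
    have hn : (n : ZMod g) = 0 := by
      have h1 := h n le_rfl
      rw [hp.closed] at h1
      rcases he with rfl | rfl <;> simpa using h1
    exact Nat.le_of_dvd (by lia) ((ZMod.natCast_eq_zero_iff n g).1 hn)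
  · have key : ∀ p e, (e = 1 ∨ e = -1) → (∀ k ≤ g, p k = p 0 + (k : ZMod g) * e) →
        stepEdges g p = Set.range fun x : ZMod g => s(x, x + 1) := by
      intro p e he h
      ext E
      constructor
      · rintro ⟨k, hk, rfl⟩
        rw [h k hk.le, h (k + 1) hk]
        push_cast
        rcases he with rfl | rfl
        · exact ⟨p 0 + k, by simp [add_assoc]⟩
        · exact ⟨p 0 - (k + 1), by
            rw [Sym2.eq_swap]; exact congrArg₂ (fun a b => s(a, b)) (by ring) (by ring)⟩
      · rintro ⟨x, rfl⟩
        rcases he with rfl | rfl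
        · have hlt := (x - p 0).val_lt
          refine ⟨(x - p 0).val, hlt, ?_⟩
          rw [h _ hlt.le, h _ hlt]
          push_cast
          rw [ZMod.natCast_zmod_val]
          exact congrArg₂ (fun a b => s(a, b)) (by ring) (by ring)
        · have hlt := (p 0 - (x + 1)).val_lt
          refine ⟨(p 0 - (x + 1)).val, hlt, ?_⟩
          rw [h _ hlt.le, h _ hlt, Sym2.eq_swap]
          push_cast
          rw [ZMod.natCast_zmod_val]
          exact congrArg₂ (fun a b => s(a, b)) (by ring) (by ring)
    rw [Set.ncard_eq_one]
    refine ⟨Set.range fun x : ZMod g => s(x, x + 1), Set.eq_singleton_iff_unique_mem.2 ⟨?_, ?_⟩⟩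
    · refine ⟨fun k => u + k, ⟨hg, by simp, fun k _ => .inl (by push_cast; ring), ?_⟩, by simp,
        (key _ 1 (.inl rfl) (by simp)).symm⟩
      intro i hi j hj hij
      have := congrArg ZMod.val (add_left_cancel hij)
      rwa [ZMod.val_cast_of_lt hi, ZMod.val_cast_of_lt hj] at this
    · rintro E ⟨p, hp, -, rfl⟩
      obtain ⟨e, he, h⟩ := zmodCycle_seq hg hp
      exact key p e he h

theorem hasBlock_cycle {g : ℕ} (hg : 3 ≤ g) : HasBlock g 2 1 0 := by
  have : NeZero g := ⟨by lia⟩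
  exact ⟨ZMod g, inferInstance, inferInstance, _, isBlock_zmodCycle hg, zero_le⟩

theorem isBlock_of_forall_not_isCyc {V : Type*} {G : SimpleGraph V} {g d : ℕ}
    (hd : ∀ u, (G.neighborSet u).ncard = d) (h : ∀ n p, ¬ IsCyc G n p) : IsBlock G g d 0 := by
  refine ⟨hd, fun n p hp => absurd hp (h n p), fun u => ?_⟩
  rw [show cycSets G g u = ∅ from Set.eq_empty_of_forall_notMem fun E ⟨p, hp, _⟩ => h g p hp]
  exact Set.ncard_empty _

theorem hasBlock_edgeless (g m : ℕ) : HasBlock g 0 0 m :=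
  ⟨Fin (m + 1), inferInstance, inferInstance, ⊥,
    isBlock_of_forall_not_isCyc (fun u => by simp [neighborSet])
      fun n p hp => hp.adj 0 (by have := hp.three_le; lia), by simp⟩

theorem hasBlock_edge (g : ℕ) : HasBlock g 1 0 0 := by
  refine ⟨Bool, inferInstance, inferInstance, ⊤, isBlock_of_forall_not_isCyc (fun u => ?_)
    fun n p hp => ?_, zero_le⟩
  · rw [Set.ncard_eq_one]
    exact ⟨!u, by ext v; cases u <;> cases v <;> simp⟩
  · have h3 := hp.three_le
    have h01 := hp.adj 0 (by lia)
    have h12 := hp.adj 1 (by lia)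
    have h02 : p 0 = p 2 := by
      simp only [top_adj] at h01 h12
      revert h01 h12
      generalize p 0 = a, p (0 + 1) = b, p 2 = c
      revert a b c
      decide
    have := hp.inj 0 (by lia) 2 (by lia) h02
    lia

/-- The edgeless block, added first, brings in the bound `m` on the order. -/
theorem HasBlock.add_edges {g d l : ℕ} (h : HasBlock g d l 0) (i m : ℕ) :
    HasBlock g (d + i) l m := by
  induction i with
  | zero => simpa using (hasBlock_edgeless g m).add h
  | succ i ih => exact ih.add (hasBlock_edge g)


end

theorem mainTheorem1 :
    (∀ k g : ℕ, 3 ≤ k → 3 ≤ g →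
      {v : ℕ | VertexGirthRegular.ExistsVGR v k g 1}.Infinite) ∧
    (∀ k g : ℕ, 4 ≤ k → 3 ≤ g →
      {v : ℕ | VertexGirthRegular.ExistsVGR v k g 2}.Infinite) ∧
    (∀ lam k g : ℕ, 3 ≤ lam → lam ≤ k → 3 ≤ g → g ≠ 4 → g ≠ 5 →
      {v : ℕ | VertexGirthRegular.ExistsVGR v k g lam}.Infinite) := by
  refine ⟨fun k g hk hg => ?_, fun k g hk hg => ?_, fun lam k g hlam hk hg h4 h5 => ?_⟩
  · refine infinite_of_hasBlock one_ne_zero fun m => ?_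
    have := (hasBlock_cycle hg).add_edges (k - 2) m
    rwa [Nat.add_sub_cancel' (by lia)] at this
  · refine infinite_of_hasBlock two_ne_zero fun m => ?_
    have := ((hasBlock_cycle hg).add (hasBlock_cycle hg)).add_edges (k - 4) m
    rwa [Nat.add_sub_cancel' (by lia)] at this
  · refine infinite_of_hasBlock (by lia) fun m => ?_
    have hb : HasBlock g lam lam 0 := by
      rcases hg.eq_or_lt with rfl | hg
      · exact hasBlock_three hlam
      · exact hasBlock_of_six_le (by lia) hlam
    have := hb.add_edges (k - lam) m
    rwa [Nat.add_sub_cancel' hk] at this
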